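/- Let $\mathbb S=\mathbb R/\mathbb Z$ with Lebesgue measure $\lambda$, let $\|\cdot\|$ be the norm of $H^0(\mathbb S)=L^2(\mathbb S)$, let $H^{-1}(\mathbb S)$ be the dual of $H^1(\mathbb S)$, and put $\||(u,\rho)|\|_{\mathbb A}=\tfrac12\sqrt{\|u_x\|^2+\|\rho\|^2}$. Let $\tilde u\in H^1(\mathbb S)$ and $\tilde\rho\in L^2(\mathbb S)$ satisfy $\tilde u(0)=0$ and $\|\tilde u_x\|^2+\|\tilde\rho\|^2=4$. For $t\ge 0$ define $$\varphi(t,x)=\int_0^x\big(f^2+g^2\big)(t,y)\,dy,\quad f(t,x)=\cos t+\tfrac12\tilde u_x(x)\sin t,\quad g(t,x)=\tfrac12\tilde\rho(x)\sin t,$$ $$\varrho(t,x)=\tilde\rho(x)\int_0^t\frac{\chi_{\{\varphi_x(s,\cdot)>0\}}(x)}{\varphi_x(s,x)}\,ds,$$ where $\varphi_x=f^2+g^2$ and $\varrho(t,x)=0$ whenever $\tilde\rho(x)=0$. Then there are $u(t,\cdot)$ and $\rho(t,\cdot)$, $t\ge0$, on $\mathbb S$ with $$u(t,\varphi(t,x))=\varphi_t(t,x)\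 \text{ for all } t\ge 0 \text{ and all } x,\qquad \rho(t,\varphi(t,x))=\varrho_t(t,x)\ \text{ for all } t\ge 0\text{ and a.e. } x,$$ and every such pair is a global weak solution of the periodic two-component Hunter--Saxton system $$u_{txx}+uu_{xxx}+2u_xu_{xx}=\rho\rho_x,\qquad \rho_t+(u\rho)_x=0$$ with initial data $(\tilde u,\tilde\rho)$, in the following sense: (a) for each $t\ge 0$, $u(t,\cdot)\in H^1(\mathbb S)$ and $\rho(t,\cdot)\in L^2(\mathbb S)$; (b) $u\in C([0,\infty)\times\mathbb S;\mathbb R)$, $u(0,\cdot)=\tilde u$ pointwise on $\mathbb S$, and $\rho(0,\cdot)=\tilde\rho$ a.e. on $\mathbb S$; (c) $t\mapsto u_x(t,\cdot)$ and $t\mapsto\rho(t,\cdot)$ belong to $L^\infty([0,\infty);L^2(\mathbb S))$; (d) $t\mapsto u(t,\cdot)$ is absolutely continuous from $[0,T]$ to $L^2(\mathbb S)$ for every $T>0$, and for a.e. $t\in[0,\infty)$ $$u_t+uu_x=\frac12\left\{\int_0^x(u_x^2+\rho^2)\,dy-x\int_{\mathbb S}(u_x^2+\rho^2)\,dy\right\}\quad\text{in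 }L^2(\mathbb S);$$ moreover $t\mapsto\rho(t,\cdot)$ is absolutely continuous from $[0,T]$ to $H^{-1}(\mathbb S)$ for every $T>0$, and for a.e. $t\in[0,\infty)$ $$\rho_t+(u\rho)_x=0\quad\text{in }H^{-1}(\mathbb S).$$ Furthermore, for every $t\ge0$, $$\||(u(t,\cdot),\rho(t,\cdot))|\|_{\mathbb A}^2=\begin{cases}\||(\tilde u,\tilde\rho)|\|_{\mathbb A}^2,&\sin t=0,\\[2pt] \||(\tilde u,\tilde\rho)|\|_{\mathbb A}^2-\dfrac1{\sin^2t}\,\lambda\big(\{\tilde u_x=-2\cot t\}\cap\{\tilde\rho=0\}\big),&\sin t\ne0,\end{cases}$$ and the solution is conservative: $$\|u_x(t,\cdot)\|^2+\|\rho(t,\cdot)\|^2=\|\tilde u_x\|^2+\|\tilde\rho\|^2\quad\text{for a.e. }t\in[0,\infty).$$ -/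

import Mathlib

open MeasureTheory Set Filter Topology
open scoped ENNReal ContDiff

namespace HunterSaxton

noncomputable section

/-! Functions on the circle `𝕊 = ℝ/ℤ` are functions on `ℝ` of period `1`. Their restrictions to the
fundamental domain `(0,1]`, with Lebesgue measure, give the Lebesgue spaces over `𝕊`. -/

/-- Lebesgue measure `λ` on the circle, on the fundamental domain `(0,1]`. -/
abbrev circleMeasure : Measure ℝ := volume.restrict (Ioc (0 : ℝ) 1)

/-- The Hilbert space `H⁰(𝕊) = L²(𝕊)` of function classes. -/
abbrev L2Circle : Type := Lp ℝ 2 circleMeasure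

/-- `f` is (a representative of) an element of `H⁰(𝕊) = L²(𝕊)`. -/
def MemL2 (f : ℝ → ℝ) : Prop :=
  Function.Periodic f 1 ∧ MemLp f 2 circleMeasure

/-- `v` is (the continuous representative of) an element of `H¹(𝕊)`: an absolutely continuous
function on the circle whose derivative, which exists almost everywhere, is square-integrable. -/
def MemH1 (v : ℝ → ℝ) : Prop :=
  Function.Periodic v 1 ∧ AbsolutelyContinuousOnInterval v 0 1 ∧
    MemLp (deriv v) 2 circleMeasure

open Classical in
/-- The class in `L²(𝕊)` of a square-integrable function (and `0` for any other function). -/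
def toL2 (f : ℝ → ℝ) : L2Circle :=
  if h : MemLp f 2 circleMeasure then h.toLp f else 0

/-- The squared norm `‖f‖² = ∫_𝕊 f²` of `L²(𝕊)`. -/
def normSq (f : ℝ → ℝ) : ℝ := ∫ x, f x ^ 2 ∂circleMeasure

/-- The norm `‖|(u,ρ)|‖_𝔸 = ½ (‖uₓ‖² + ‖ρ‖²)^{1/2}`. -/
def normA (u ρ : ℝ → ℝ) : ℝ := 1 / 2 * √(normSq (deriv u) + normSq ρ)

/-! ### The space `H⁻¹(𝕊)` -/

/-- The Hilbert space `H¹(𝕊)`, as the space of pairs `(v, vₓ)` in `L²(𝕊) × L²(𝕊)`, the second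
component being the weak derivative of the first. -/
def H1Circle : Submodule ℝ (WithLp 2 (L2Circle × L2Circle)) where
  carrier := {p | ∀ θ : ℝ → ℝ, ContDiff ℝ ∞ θ → Function.Periodic θ 1 →
    inner ℝ p.fst (toL2 (deriv θ)) + inner ℝ p.snd (toL2 θ) = 0}
  zero_mem' := by
    intro θ _ _
    simp
  add_mem' := by
    intro p q hp hq θ h1 h2
    have h3 := hp θ h1 h2
    have h4 := hq θ h1 h2
    simp only [WithLp.add_fst, WithLp.add_snd, inner_add_left]
    linarith
  smul_mem' := by
    intro c p hp θ h1 h2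
    have h3 := hp θ h1 h2
    simp only [WithLp.smul_fst, WithLp.smul_snd, real_inner_smul_left]
    rw [← mul_add, h3, mul_zero]

/-- The space `H⁻¹(𝕊)`, the dual of `H¹(𝕊)`, with its dual norm. -/
abbrev HNegOne : Type := H1Circle →L[ℝ] ℝ

/-- The embedding of `L²(𝕊)` in `H⁻¹(𝕊)`: `f` acts as `v ↦ ∫_𝕊 f v`. -/
def toHNegOne (f : L2Circle) : HNegOne :=
  (innerSL ℝ f).comp ((WithLp.fstL 2 ℝ L2Circle L2Circle).comp H1Circle.subtypeL)

/-- The distributional derivative `∂ₓ : L²(𝕊) → H⁻¹(𝕊)`: `∂ₓ f` acts as `v ↦ - ∫_𝕊 f vₓ`. -/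
def weakDx (f : L2Circle) : HNegOne :=
  -(innerSL ℝ f).comp ((WithLp.sndL 2 ℝ L2Circle L2Circle).comp H1Circle.subtypeL)

/-! ### Weak solutions -/

/-- `(u, ρ)`, as functions of `t ≥ 0` and `x`, is a global weak solution of the periodic
two-component Hunter-Saxton system with initial data `(u₀, ρ₀)`. -/
structure IsGlobalWeakSolution (u₀ ρ₀ : ℝ → ℝ) (u ρ : ℝ → ℝ → ℝ) : Prop where
  memH1 : ∀ t, 0 ≤ t → MemH1 (u t)
  memL2 : ∀ t, 0 ≤ t → MemL2 (ρ t)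
  continuousOn : ContinuousOn (Function.uncurry u) (Ici 0 ×ˢ univ)
  initial_u : ∀ x, u 0 x = u₀ x
  initial_ρ : ρ 0 =ᵐ[volume] ρ₀
  /-- `t ↦ uₓ(t,·)` belongs to `L^∞([0,∞); H⁰(𝕊))`. -/
  bounded_ux : MemLp (fun t => toL2 (deriv (u t))) ∞ (volume.restrict (Ici (0 : ℝ)))
  /-- `t ↦ ρ(t,·)` belongs to `L^∞([0,∞); H⁰(𝕊))`. -/
  bounded_ρ : MemLp (fun t => toL2 (ρ t)) ∞ (volume.restrict (Ici (0 : ℝ)))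
  /-- `t ↦ u(t,·)` is absolutely continuous with values in `H⁰(𝕊)`. -/
  absCont_u : ∀ T, 0 < T → AbsolutelyContinuousOnInterval (fun t => toL2 (u t)) 0 T
  /-- `u_t + u uₓ = ½ {∫₀ˣ (uₓ² + ρ²) dy - x ∫_𝕊 (uₓ² + ρ²) dy}` in `H⁰(𝕊)`, a.e. in time. -/
  equation_u : ∀ᵐ t ∂(volume.restrict (Ici (0 : ℝ))),
    HasDerivAt (fun s => toL2 (u s))
      (toL2 (fun x => 1 / 2 * ((∫ y in (0 : ℝ)..x, (deriv (u t) y ^ 2 + ρ t y ^ 2)) -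
          x * ∫ y in (0 : ℝ)..1, (deriv (u t) y ^ 2 + ρ t y ^ 2)))
        - toL2 (fun x => u t x * deriv (u t) x)) t
  /-- `t ↦ ρ(t,·)` is absolutely continuous with values in `H⁻¹(𝕊)`. -/
  absCont_ρ : ∀ T, 0 < T → AbsolutelyContinuousOnInterval (fun t => toHNegOne (toL2 (ρ t))) 0 T
  /-- `ρ_t + (u ρ)ₓ = 0` in `H⁻¹(𝕊)`, a.e. in time. -/
  equation_ρ : ∀ᵐ t ∂(volume.restrict (Ici (0 : ℝ))),
    HasDerivAt (fun s => toHNegOne (toL2 (ρ s)))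
      (-weakDx (toL2 (fun x => u t x * ρ t x))) t

/-! ### The weak geodesic flow with initial velocity `(u₀, ρ₀)` -/

/-- The function `f(t,x) = cos t + ½ ũₓ(x) sin t`. -/
def geoF (u₀ : ℝ → ℝ) (t x : ℝ) : ℝ := Real.cos t + deriv u₀ x / 2 * Real.sin t

/-- The function `g(t,x) = ½ ρ̃(x) sin t`. -/
def geoG (ρ₀ : ℝ → ℝ) (t x : ℝ) : ℝ := ρ₀ x / 2 * Real.sin t

/-- `φₓ(t,x) = f(t,x)² + g(t,x)²`, the spatial derivative of `geoPhi`. -/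
def geoPhiX (u₀ ρ₀ : ℝ → ℝ) (t x : ℝ) : ℝ := geoF u₀ t x ^ 2 + geoG ρ₀ t x ^ 2

/-- `φ(t,x) = ∫₀ˣ (f(t,y)² + g(t,y)²) dy`. -/
def geoPhi (u₀ ρ₀ : ℝ → ℝ) (t x : ℝ) : ℝ := ∫ y in (0 : ℝ)..x, geoPhiX u₀ ρ₀ t y

open Classical in
/-- `ϱ(t,x) = ρ̃(x) ∫₀ᵗ χ_{φₓ(s,·) > 0}(x) / φₓ(s,x) ds`. It vanishes where `ρ̃` does. -/
def geoRho (u₀ ρ₀ : ℝ → ℝ) (t x : ℝ) : ℝ :=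
  ρ₀ x * ∫ s in (0 : ℝ)..t, if 0 < geoPhiX u₀ ρ₀ s x then 1 / geoPhiX u₀ ρ₀ s x else 0

/-- The pair `(u, ρ)` of time-dependent functions on the circle is given by the geodesic flow:
`u(t, φ(t,x)) = φ_t(t,x)` everywhere, and `ρ(t, φ(t,x)) = ϱ_t(t,x)` for almost every `x`
(`ρ(t,·)` is a class of functions), for all `t ≥ 0`. The time derivatives are one-sided
at `t = 0`. -/
structure IsGivenByFlow (u₀ ρ₀ : ℝ → ℝ) (u ρ : ℝ → ℝ → ℝ) : Prop where
  periodic_u : ∀ t, 0 ≤ t → Function.Periodic (u t) 1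
  periodic_ρ : ∀ t, 0 ≤ t → Function.Periodic (ρ t) 1
  comp_u : ∀ t, 0 ≤ t → ∀ x,
    HasDerivWithinAt (fun s => geoPhi u₀ ρ₀ s x) (u t (geoPhi u₀ ρ₀ t x)) (Ici 0) t
  comp_ρ : ∀ t, 0 ≤ t → ∀ᵐ x,
    HasDerivWithinAt (fun s => geoRho u₀ ρ₀ s x) (ρ t (geoPhi u₀ ρ₀ t x)) (Ici 0) t

end

end HunterSaxton

open HunterSaxton

namespace HunterSaxton

/-! The pair (f, g) solves the harmonic oscillator equation in t for each x, and φ_x = f² + g² is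
the squared length of that vector. Write q = f_t² + g_t². The Wronskian of (f, g) is ρ₀/2, so
Lagrange's identity reads φ_tx² + ρ₀² = 4 φ_x q (`geoPhiTX_sq_add_sq`). Hence φ_tx and ρ₀ vanish
wherever φ_x does. The map φ(t,·) is nondecreasing of degree one but may have plateaus. On these φ_t
is constant, so u is well defined by u∘φ = φ_t, and since φ pushes φ_x dx forward to Lebesgue
measure (`map_densityOn`), u_x∘φ = φ_tx/φ_x and ρ∘φ = ρ₀/φ_x hold where φ_x ≠ 0.

Energy: (u_x² + ρ²)∘φ · φ_x equals 4q off the zero set of φ_x and 0 on it. As q has integral 1, and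
q = 1/sin² t where φ_x = 0, the energy formula follows. Energy is lost only when some level set of
u₀' has positive measure, which happens at countably many times (`countable_exceptionalTimes`).

Equations: pairings of u and ρ with a smooth θ become integrals in x over a fixed interval with no
division by φ_x, so they are differentiable at every time with bounded derivative. Off the
exceptional times the derivative is the tested equation, because the source term composed with φ is
φ_tt (`source_comp`). Density of trigonometric functions turns these scalar estimates into Lipschitz
bounds in L² and H⁻¹. At a nonexceptional time the energy attains its maximum 4, so weak continuity
of (u_x, ρ) is strong continuity (`tendsto_norm_sq_of_weak`). The right-hand sides are then
continuous there, and the tested derivative is a norm derivative (`hasDerivAt_of_tested`). -/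

/-! ### Primitives of nonnegative densities as changes of variables -/

/-- An almost-everywhere statement passes to the image measure under a continuous map, without
any measurability of the predicate. -/
theorem ae_map_of_ae_comp_of_continuous {μ : Measure ℝ} [IsFiniteMeasure μ] {Φ : ℝ → ℝ}
    (hΦ : Continuous Φ) {q : ℝ → Prop} (h : ∀ᵐ x ∂μ, q (Φ x)) : ∀ᵐ y ∂(μ.map Φ), q y := by
  obtain ⟨N, hN, hNm, hN0⟩ := exists_measurable_superset_of_null (ae_iff.1 h)
  rw [ae_iff]
  refine le_antisymm (ENNReal.le_of_forall_pos_le_add fun ε hε _ => ?_) bot_le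
  -- Inner regularity: `Φ '' K` is compact, hence measurable, and misses every bad value, although
  -- the bad set itself need not be measurable.
  obtain ⟨K, hKN, hK, hμ⟩ := hNm.compl.exists_isCompact_sdiff_lt (μ := μ) (measure_ne_top _ _)
    (ε := (ε : ℝ≥0∞)) (by simpa using hε.ne')
  have hKm : MeasurableSet (Φ '' K) := (hK.image hΦ).isClosed.measurableSet
  have hsub : {y | ¬ q y} ⊆ (Φ '' K)ᶜ := by
    rintro y hy ⟨x, hx, rfl⟩
    exact hKN hx (hN hy)
  calc μ.map Φ {y | ¬ q y} ≤ μ.map Φ (Φ '' K)ᶜ := measure_mono hsub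
    _ = μ (Φ ⁻¹' (Φ '' K)ᶜ) := Measure.map_apply hΦ.measurable hKm.compl
    _ ≤ μ (N ∪ (Nᶜ \ K)) := by
        refine measure_mono fun x hx => ?_
        by_cases hxN : x ∈ N
        · exact Or.inl hxN
        · exact Or.inr ⟨hxN, fun hxK => hx ⟨x, hxK, rfl⟩⟩
    _ ≤ μ N + μ (Nᶜ \ K) := measure_union_le _ _
    _ ≤ 0 + ε := by rw [hN0]; gcongr

section Primitive

variable {p Φ : ℝ → ℝ}

theorem sub_eq_integral_of_primitive (hpi : ∀ c d, IntervalIntegrable p volume c d)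
    (hΦ : ∀ x, Φ x = ∫ y in (0 : ℝ)..x, p y) (c d : ℝ) : Φ d - Φ c = ∫ y in c..d, p y := by
  rw [hΦ, hΦ, intervalIntegral.integral_interval_sub_left (hpi _ _) (hpi _ _)]

theorem monotone_of_primitive (hp : ∀ x, 0 ≤ p x) (hpi : ∀ c d, IntervalIntegrable p volume c d)
    (hΦ : ∀ x, Φ x = ∫ y in (0 : ℝ)..x, p y) : Monotone Φ := fun c d hcd => by
  have := sub_eq_integral_of_primitive hpi hΦ c d
  have := intervalIntegral.integral_nonneg (μ := volume) hcd fun x _ => hp x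
  linarith

theorem continuous_of_primitive (hpi : ∀ c d, IntervalIntegrable p volume c d)
    (hΦ : ∀ x, Φ x = ∫ y in (0 : ℝ)..x, p y) : Continuous Φ := by
  rw [show Φ = fun x => ∫ y in (0 : ℝ)..x, p y from funext hΦ]
  exact intervalIntegral.continuous_primitive hpi 0

/-- The measure `p dx` on `(c, d]`. -/
noncomputable abbrev densityOn (p : ℝ → ℝ) (c d : ℝ) : Measure ℝ :=
  (volume.restrict (Ioc c d)).withDensity fun x => ENNReal.ofReal (p x)

theorem densityOn_Ioc (hp : ∀ x, 0 ≤ p x) (hpi : ∀ c d, IntervalIntegrable p volume c d)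
    (hΦ : ∀ x, Φ x = ∫ y in (0 : ℝ)..x, p y) {c d x : ℝ} (hcx : c ≤ x) (hxd : x ≤ d) :
    densityOn p c d (Ioc c x) = ENNReal.ofReal (Φ x - Φ c) := by
  rw [withDensity_apply _ measurableSet_Ioc, Measure.restrict_restrict measurableSet_Ioc,
    inter_eq_left.2 (Ioc_subset_Ioc_right hxd), sub_eq_integral_of_primitive hpi hΦ,
    intervalIntegral.integral_of_le hcx, ofReal_integral_eq_lintegral_ofReal]
  · exact (intervalIntegrable_iff_integrableOn_Ioc_of_le hcx).1 (hpi _ _)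
  · exact ae_of_all _ hp

theorem isFiniteMeasure_densityOn (hpi : ∀ c d, IntervalIntegrable p volume c d) {c d : ℝ}
    (hcd : c ≤ d) : IsFiniteMeasure (densityOn p c d) :=
  isFiniteMeasure_withDensity_ofReal
    ((intervalIntegrable_iff_integrableOn_Ioc_of_le hcd).1 (hpi _ _)).2

/-- A nondecreasing primitive `Φ` of `p` maps `p dx` to Lebesgue measure. -/
theorem map_densityOn (hp : ∀ x, 0 ≤ p x) (hpi : ∀ c d, IntervalIntegrable p volume c d)
    (hΦ : ∀ x, Φ x = ∫ y in (0 : ℝ)..x, p y) {c d : ℝ} (hcd : c ≤ d) :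
    (densityOn p c d).map Φ = volume.restrict (Ioc (Φ c) (Φ d)) := by
  have hmono := monotone_of_primitive hp hpi hΦ
  have hcont := continuous_of_primitive hpi hΦ
  have := isFiniteMeasure_densityOn hpi hcd
  have hnull : densityOn p c d (Ioc c d)ᶜ = 0 :=
    withDensity_absolutelyContinuous _ _ (by simp [Measure.restrict_apply measurableSet_Ioc.compl])
  have hcap : ∀ A, densityOn p c d A = densityOn p c d (A ∩ Ioc c d) := fun A => by
    refine le_antisymm ?_ (measure_mono inter_subset_left)
    calc _ ≤ densityOn p c d ((A ∩ Ioc c d) ∪ (Ioc c d)ᶜ) :=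
          measure_mono fun x hx => by by_cases h : x ∈ Ioc c d <;> simp_all
      _ ≤ _ := (measure_union_le _ _).trans (by rw [hnull, add_zero])
  refine Measure.ext_of_Iic _ _ fun y => ?_
  rw [Measure.map_apply hcont.measurable measurableSet_Iic,
    Measure.restrict_apply measurableSet_Iic, hcap]
  rcases lt_or_ge y (Φ c) with hy | hy
  · have h1 : Φ ⁻¹' Iic y ∩ Ioc c d = ∅ := by
      ext x
      simp only [mem_inter_iff, mem_preimage, mem_Iic, mem_Ioc, mem_empty_iff_false, iff_false]
      rintro ⟨h, h', -⟩
      exact absurd (hmono h'.le) (by linarith)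
    have h2 : Iic y ∩ Ioc (Φ c) (Φ d) = ∅ := by
      ext x
      simp only [mem_inter_iff, mem_Iic, mem_Ioc, mem_empty_iff_false, iff_false]
      rintro ⟨h, h', -⟩
      linarith
    rw [h1, h2, measure_empty, measure_empty]
  rcases le_or_gt (Φ d) y with hy' | hy'
  · have h1 : Φ ⁻¹' Iic y ∩ Ioc c d = Ioc c d :=
      inter_eq_right.2 fun x hx => (hmono hx.2).trans hy'
    have h2 : Iic y ∩ Ioc (Φ c) (Φ d) = Ioc (Φ c) (Φ d) :=
      inter_eq_right.2 fun x hx => hx.2.trans hy'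
    rw [h1, h2, densityOn_Ioc hp hpi hΦ hcd le_rfl, Real.volume_Ioc]
  -- The greatest solution of `Φ x ≤ y` is the right end of any plateau at height `y`, so the
  -- preimage of `Iic y` inside `(c, d]` is exactly `(c, x]`.
  obtain ⟨x, ⟨⟨hcx, hxd⟩, hxy⟩, hx⟩ := ((isCompact_Icc (a := c) (b := d)).inter_right
    (isClosed_Iic.preimage hcont : IsClosed (Φ ⁻¹' Iic y))).exists_isGreatest
    ⟨c, left_mem_Icc.2 hcd, hy⟩
  obtain ⟨z, hz, rfl⟩ := intermediate_value_Icc hcd hcont.continuousOn ⟨hy, hy'.le⟩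
  have hzx : Φ x = Φ z := le_antisymm hxy (hmono (hx ⟨hz, le_refl (Φ z)⟩))
  have h1 : Φ ⁻¹' Iic (Φ z) ∩ Ioc c d = Ioc c x := by
    ext w
    simp only [mem_inter_iff, mem_preimage, mem_Iic, mem_Ioc]
    constructor
    · rintro ⟨h, h', h''⟩
      exact ⟨h', hx ⟨⟨h'.le, h''⟩, h⟩⟩
    · rintro ⟨h, h'⟩
      exact ⟨(hmono h').trans hxy, h, h'.trans hxd⟩
  have h2 : Iic (Φ z) ∩ Ioc (Φ c) (Φ d) = Ioc (Φ c) (Φ z) := by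
    ext w
    simp only [mem_inter_iff, mem_Iic, mem_Ioc]
    constructor
    · rintro ⟨h, h', -⟩
      exact ⟨h', h⟩
    · rintro ⟨h, h'⟩
      exact ⟨h', h, h'.trans (hmono hz.2)⟩
  rw [h1, h2, densityOn_Ioc hp hpi hΦ hcx hxd, Real.volume_Ioc, hzx]

theorem ae_densityOn_iff (hpi : ∀ c d, IntervalIntegrable p volume c d) (hp : ∀ x, 0 ≤ p x)
    {c d : ℝ} (hcd : c ≤ d) {q : ℝ → Prop} :
    (∀ᵐ x ∂(densityOn p c d), q x) ↔ ∀ᵐ x ∂(volume.restrict (Ioc c d)), p x ≠ 0 → q x := by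
  have hm : AEMeasurable p (volume.restrict (Ioc c d)) :=
    ((intervalIntegrable_iff_integrableOn_Ioc_of_le hcd).1 (hpi _ _)).aemeasurable
  rw [ae_withDensity_iff' hm.ennreal_ofReal]
  refine eventually_congr (ae_of_all _ fun x => ?_)
  have : ENNReal.ofReal (p x) ≠ 0 ↔ p x ≠ 0 := by
    rw [Ne, ENNReal.ofReal_eq_zero, not_le]
    exact ⟨fun h => h.ne', fun h => lt_of_le_of_ne (hp x) (Ne.symm h)⟩
  rw [this]

theorem integral_densityOn (hpi : ∀ c d, IntervalIntegrable p volume c d) (hp : ∀ x, 0 ≤ p x)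
    {c d : ℝ} (hcd : c ≤ d) (k : ℝ → ℝ) :
    ∫ x, k x ∂(densityOn p c d) = ∫ x in c..d, k x * p x := by
  have hm : AEMeasurable p (volume.restrict (Ioc c d)) :=
    ((intervalIntegrable_iff_integrableOn_Ioc_of_le hcd).1 (hpi _ _)).aemeasurable
  rw [integral_withDensity_eq_integral_toReal_smul₀ hm.ennreal_ofReal
    (ae_of_all _ fun _ => ENNReal.ofReal_lt_top), intervalIntegral.integral_of_le hcd]
  refine integral_congr_ae (ae_of_all _ fun x => ?_)
  simp [ENNReal.toReal_ofReal (hp x), mul_comm]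

theorem integrable_densityOn_iff (hpi : ∀ c d, IntervalIntegrable p volume c d)
    (hp : ∀ x, 0 ≤ p x) {c d : ℝ} (hcd : c ≤ d) (k : ℝ → ℝ) :
    Integrable k (densityOn p c d) ↔ IntervalIntegrable (fun x => k x * p x) volume c d := by
  have hm : AEMeasurable p (volume.restrict (Ioc c d)) :=
    ((intervalIntegrable_iff_integrableOn_Ioc_of_le hcd).1 (hpi _ _)).aemeasurable
  rw [integrable_withDensity_iff_integrable_smul₀' hm.ennreal_ofReal
    (ae_of_all _ fun _ => ENNReal.ofReal_lt_top), intervalIntegrable_iff_integrableOn_Ioc_of_le hcd]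
  refine integrable_congr (ae_of_all _ fun x => ?_)
  simp [ENNReal.toReal_ofReal (hp x), mul_comm]

/-- Substitution `y = Φ x`. -/
theorem integral_comp_primitive (hp : ∀ x, 0 ≤ p x)
    (hpi : ∀ c d, IntervalIntegrable p volume c d) (hΦ : ∀ x, Φ x = ∫ y in (0 : ℝ)..x, p y)
    {c d : ℝ} (hcd : c ≤ d) {k : ℝ → ℝ}
    (hk : AEStronglyMeasurable k (volume.restrict (Ioc (Φ c) (Φ d)))) :
    ∫ y in Φ c..Φ d, k y = ∫ x in c..d, k (Φ x) * p x := by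
  have hcont := continuous_of_primitive hpi hΦ
  rw [intervalIntegral.integral_of_le (monotone_of_primitive hp hpi hΦ hcd),
    ← map_densityOn hp hpi hΦ hcd, integral_map hcont.aemeasurable, integral_densityOn hpi hp hcd]
  rwa [map_densityOn hp hpi hΦ hcd]

/-- Zeros of `p` carry no mass of `p dx`, so the values of `Φ` taken there can be ignored. The
predicate may be non-measurable. -/
theorem ae_of_ae_comp_primitive (hp : ∀ x, 0 ≤ p x)
    (hpi : ∀ c d, IntervalIntegrable p volume c d) (hΦ : ∀ x, Φ x = ∫ y in (0 : ℝ)..x, p y)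
    {c d : ℝ} (hcd : c ≤ d) {q : ℝ → Prop}
    (h : ∀ᵐ x ∂(volume.restrict (Ioc c d)), p x ≠ 0 → q (Φ x)) :
    ∀ᵐ y ∂(volume.restrict (Ioc (Φ c) (Φ d))), q y := by
  have := isFiniteMeasure_densityOn hpi hcd
  rw [← map_densityOn hp hpi hΦ hcd]
  exact ae_map_of_ae_comp_of_continuous (continuous_of_primitive hpi hΦ)
    ((ae_densityOn_iff hpi hp hcd).2 h)

theorem ae_comp_primitive_of_ae (hp : ∀ x, 0 ≤ p x)
    (hpi : ∀ c d, IntervalIntegrable p volume c d) (hΦ : ∀ x, Φ x = ∫ y in (0 : ℝ)..x, p y)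
    {c d : ℝ} (hcd : c ≤ d) {q : ℝ → Prop}
    (h : ∀ᵐ y ∂(volume.restrict (Ioc (Φ c) (Φ d))), q y) :
    ∀ᵐ x ∂(volume.restrict (Ioc c d)), p x ≠ 0 → q (Φ x) := by
  rw [← map_densityOn hp hpi hΦ hcd] at h
  exact (ae_densityOn_iff hpi hp hcd).1
    (ae_of_ae_map (continuous_of_primitive hpi hΦ).aemeasurable h)

end Primitive

/-! ### The geodesic flow -/

/-- Initial data of energy `4` with `u₀ 0 = 0`. -/
structure IsUnitData (u₀ ρ₀ : ℝ → ℝ) : Prop where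
  memH1 : MemH1 u₀
  memL2 : MemL2 ρ₀
  zero : u₀ 0 = 0
  energy : normSq (deriv u₀) + normSq ρ₀ = 4

/-- The function `∫₀ˣ (ũₓ² + ρ̃²)`. -/
noncomputable def cumEnergy (u₀ ρ₀ : ℝ → ℝ) (x : ℝ) : ℝ :=
  ∫ y in (0 : ℝ)..x, (deriv u₀ y ^ 2 + ρ₀ y ^ 2)

/-- The time derivative of `geoPhi`. -/
noncomputable def geoPhiT (u₀ ρ₀ : ℝ → ℝ) (t x : ℝ) : ℝ :=
  -2 * Real.sin t * Real.cos t * x + (Real.cos t ^ 2 - Real.sin t ^ 2) * u₀ x +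
    Real.sin t * Real.cos t / 2 * cumEnergy u₀ ρ₀ x

/-- The second time derivative of `geoPhi`. -/
noncomputable def geoPhiTT (u₀ ρ₀ : ℝ → ℝ) (t x : ℝ) : ℝ :=
  -2 * (Real.cos t ^ 2 - Real.sin t ^ 2) * x - 4 * Real.sin t * Real.cos t * u₀ x +
    (Real.cos t ^ 2 - Real.sin t ^ 2) / 2 * cumEnergy u₀ ρ₀ x

/-- The mixed derivative of `geoPhi`. -/
noncomputable def geoPhiTX (u₀ ρ₀ : ℝ → ℝ) (t x : ℝ) : ℝ :=
  -2 * Real.sin t * Real.cos t + (Real.cos t ^ 2 - Real.sin t ^ 2) * deriv u₀ x +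
    Real.sin t * Real.cos t / 2 * (deriv u₀ x ^ 2 + ρ₀ x ^ 2)

/-- The function `f_t² + g_t²`. -/
noncomputable def geoQ (u₀ ρ₀ : ℝ → ℝ) (t x : ℝ) : ℝ :=
  (-Real.sin t + deriv u₀ x / 2 * Real.cos t) ^ 2 + (ρ₀ x / 2 * Real.cos t) ^ 2

variable {u₀ ρ₀ : ℝ → ℝ}

theorem geoPhiX_nonneg (t x : ℝ) : 0 ≤ geoPhiX u₀ ρ₀ t x := by
  unfold geoPhiX; positivity

theorem geoQ_nonneg (t x : ℝ) : 0 ≤ geoQ u₀ ρ₀ t x := by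
  unfold geoQ; positivity

/-- Separation of variables: only three fixed integrable functions of x occur, 1, u₀' and u₀'² +
ρ₀², with trigonometric coefficients. Integrals in x and derivatives in t are then explicit. -/
theorem geoPhiX_eq (t x : ℝ) : geoPhiX u₀ ρ₀ t x = Real.cos t ^ 2 +
    Real.sin t * Real.cos t * deriv u₀ x +
      Real.sin t ^ 2 / 4 * (deriv u₀ x ^ 2 + ρ₀ x ^ 2) := by
  unfold geoPhiX geoF geoG; ring

theorem geoQ_eq (t x : ℝ) : geoQ u₀ ρ₀ t x = Real.sin t ^ 2 -
    Real.sin t * Real.cos t * deriv u₀ x +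
      Real.cos t ^ 2 / 4 * (deriv u₀ x ^ 2 + ρ₀ x ^ 2) := by
  unfold geoQ; ring

/-- Conservation of energy for the oscillator (f, g)_tt = −(f, g). It also gives a bound on φ_x
independent of t. -/
theorem geoPhiX_add_geoQ (t x : ℝ) :
    geoPhiX u₀ ρ₀ t x + geoQ u₀ ρ₀ t x = 1 + (deriv u₀ x ^ 2 + ρ₀ x ^ 2) / 4 := by
  rw [geoPhiX_eq, geoQ_eq]
  linear_combination (1 + (deriv u₀ x ^ 2 + ρ₀ x ^ 2) / 4) * Real.sin_sq_add_cos_sq t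

/-- Lagrange's identity for `(f, g)` and its time derivative. -/
theorem geoPhiTX_sq_add_sq (t x : ℝ) :
    geoPhiTX u₀ ρ₀ t x ^ 2 + ρ₀ x ^ 2 = 4 * geoPhiX u₀ ρ₀ t x * geoQ u₀ ρ₀ t x := by
  have h1 := Real.sin_sq_add_cos_sq t
  have h2 : geoPhiTX u₀ ρ₀ t x = 2 * (geoF u₀ t x * (-Real.sin t + deriv u₀ x / 2 * Real.cos t) +
      geoG ρ₀ t x * (ρ₀ x / 2 * Real.cos t)) := by
    unfold geoPhiTX geoF geoG; ring
  -- The Wronskian f g_t − g f_t is constant in time and equals ρ₀/2.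
  have h3 : ρ₀ x = 2 * (geoF u₀ t x * (ρ₀ x / 2 * Real.cos t) -
      geoG ρ₀ t x * (-Real.sin t + deriv u₀ x / 2 * Real.cos t)) := by
    unfold geoF geoG
    linear_combination (-ρ₀ x) * h1
  rw [h2]
  nth_rewrite 2 [h3]
  unfold geoPhiX geoQ
  ring

/-- Lagrange's identity makes a sum of two squares vanish with φ_x. This is what keeps u
single-valued on plateaus of φ. -/
theorem geoPhiTX_eq_zero {t x : ℝ} (h : geoPhiX u₀ ρ₀ t x = 0) : geoPhiTX u₀ ρ₀ t x = 0 := by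
  have := geoPhiTX_sq_add_sq (u₀ := u₀) (ρ₀ := ρ₀) t x
  rw [h] at this
  nlinarith [sq_nonneg (geoPhiTX u₀ ρ₀ t x), sq_nonneg (ρ₀ x)]

theorem density_eq_zero {t x : ℝ} (h : geoPhiX u₀ ρ₀ t x = 0) : ρ₀ x = 0 := by
  have := geoPhiTX_sq_add_sq (u₀ := u₀) (ρ₀ := ρ₀) t x
  rw [h] at this
  nlinarith [sq_nonneg (geoPhiTX u₀ ρ₀ t x), sq_nonneg (ρ₀ x)]

theorem geoPhiX_eq_zero_iff {t x : ℝ} : geoPhiX u₀ ρ₀ t x = 0 ↔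
    Real.sin t ≠ 0 ∧ deriv u₀ x = -2 * Real.cot t ∧ ρ₀ x = 0 := by
  constructor
  · intro h
    have hb := density_eq_zero h
    have hs : Real.sin t ≠ 0 := fun hs => by
      rw [geoPhiX_eq, hs] at h
      have := Real.sin_sq_add_cos_sq t
      rw [hs] at this
      nlinarith
    refine ⟨hs, ?_, hb⟩
    have hf : geoF u₀ t x = 0 := by
      unfold geoPhiX geoG at h
      rw [hb] at h
      simpa using h
    unfold geoF at hf
    rw [Real.cot_eq_cos_div_sin]
    field_simp
    linarith
  · rintro ⟨hs, ha, hb⟩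
    unfold geoPhiX geoF geoG
    rw [ha, hb, Real.cot_eq_cos_div_sin]
    field_simp
    ring

/-- Here g_t = 0 and f_t = −sin t − cot t cos t = −1/sin t. This is the origin of the factor 1/sin²
t in the energy loss. -/
theorem geoQ_of_geoPhiX_eq_zero {t x : ℝ} (h : geoPhiX u₀ ρ₀ t x = 0) :
    geoQ u₀ ρ₀ t x = 1 / Real.sin t ^ 2 := by
  obtain ⟨hs, ha, hb⟩ := geoPhiX_eq_zero_iff.1 h
  unfold geoQ
  rw [ha, hb, Real.cot_eq_cos_div_sin]
  have h1 := Real.sin_sq_add_cos_sq t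
  field_simp
  nlinarith [h1]

/-- If ρ₀ x ≠ 0 then φ_x(·, x) never vanishes, so the indicator is superfluous and the integrand is
continuous in time. If ρ₀ x = 0 both sides are zero. -/
theorem hasDerivAt_geoRho (t x : ℝ) :
    HasDerivAt (fun s => geoRho u₀ ρ₀ s x) (ρ₀ x / geoPhiX u₀ ρ₀ t x) t := by
  unfold geoRho
  by_cases hb : ρ₀ x = 0
  · simp only [hb, zero_mul, zero_div]
    exact hasDerivAt_const _ _
  have hp : ∀ s, 0 < geoPhiX u₀ ρ₀ s x := fun s =>
    lt_of_le_of_ne (geoPhiX_nonneg s x) fun h => hb (density_eq_zero h.symm)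
  simp only [hp, if_true]
  have hc : Continuous fun s => 1 / geoPhiX u₀ ρ₀ s x := by
    refine Continuous.div continuous_const ?_ fun s => (hp s).ne'
    unfold geoPhiX geoF geoG
    fun_prop
  have := (hc.integral_hasStrictDerivAt 0 t).hasDerivAt.const_mul (ρ₀ x)
  simpa [div_eq_mul_inv] using this

/-! ### Closed formulas for φ and its derivatives, and φ as a degree-one map of the circle. -/

namespace IsUnitData

variable (h : IsUnitData u₀ ρ₀)
include h

theorem periodic_u : Function.Periodic u₀ 1 := h.memH1.1

theorem periodic_ρ : Function.Periodic ρ₀ 1 := h.memL2.1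

theorem periodic_deriv : Function.Periodic (deriv u₀) 1 := fun x => by
  rw [← deriv_comp_add_const]
  congr 1
  exact funext h.periodic_u

theorem intervalIntegrable_deriv (c d : ℝ) : IntervalIntegrable (deriv u₀) volume c d := by
  refine h.periodic_deriv.intervalIntegrable₀ one_ne_zero ?_ c d
  rw [intervalIntegrable_iff_integrableOn_Ioc_of_le zero_le_one]
  exact h.memH1.2.2.integrable one_le_two

theorem intervalIntegrable_ρ (c d : ℝ) : IntervalIntegrable ρ₀ volume c d := by
  refine h.periodic_ρ.intervalIntegrable₀ one_ne_zero ?_ c d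
  rw [intervalIntegrable_iff_integrableOn_Ioc_of_le zero_le_one]
  exact h.memL2.2.integrable one_le_two

theorem intervalIntegrable_deriv_sq (c d : ℝ) :
    IntervalIntegrable (fun x => deriv u₀ x ^ 2) volume c d := by
  refine Function.Periodic.intervalIntegrable₀ (T := 1) (fun x => by
    simp only [h.periodic_deriv x]) one_ne_zero ?_ c d
  rw [intervalIntegrable_iff_integrableOn_Ioc_of_le zero_le_one]
  exact h.memH1.2.2.integrable_sq

theorem intervalIntegrable_ρ_sq (c d : ℝ) :
    IntervalIntegrable (fun x => ρ₀ x ^ 2) volume c d := by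
  refine Function.Periodic.intervalIntegrable₀ (T := 1) (fun x => by
    simp only [h.periodic_ρ x]) one_ne_zero ?_ c d
  rw [intervalIntegrable_iff_integrableOn_Ioc_of_le zero_le_one]
  exact h.memL2.2.integrable_sq

theorem intervalIntegrable_energy (c d : ℝ) :
    IntervalIntegrable (fun x => deriv u₀ x ^ 2 + ρ₀ x ^ 2) volume c d :=
  (h.intervalIntegrable_deriv_sq c d).add (h.intervalIntegrable_ρ_sq c d)

theorem intervalIntegrable_geoPhiX (t c d : ℝ) :
    IntervalIntegrable (geoPhiX u₀ ρ₀ t) volume c d := by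
  rw [show geoPhiX u₀ ρ₀ t = _ from funext (geoPhiX_eq t)]
  exact (intervalIntegrable_const.add ((h.intervalIntegrable_deriv c d).const_mul _)).add
    ((h.intervalIntegrable_energy c d).const_mul _)

theorem intervalIntegrable_geoQ (t c d : ℝ) :
    IntervalIntegrable (geoQ u₀ ρ₀ t) volume c d := by
  rw [show geoQ u₀ ρ₀ t = _ from funext (geoQ_eq t)]
  exact (intervalIntegrable_const.sub ((h.intervalIntegrable_deriv c d).const_mul _)).add
    ((h.intervalIntegrable_energy c d).const_mul _)

theorem intervalIntegrable_geoPhiTX (t c d : ℝ) :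
    IntervalIntegrable (geoPhiTX u₀ ρ₀ t) volume c d :=
  (intervalIntegrable_const.add ((h.intervalIntegrable_deriv c d).const_mul _)).add
    ((h.intervalIntegrable_energy c d).const_mul _)

/-- `u₀` is the primitive of its derivative. -/
theorem integral_deriv (x : ℝ) : ∫ y in (0 : ℝ)..x, deriv u₀ y = u₀ x := by
  have hI : ∀ y ∈ Icc (0 : ℝ) 1, ∫ z in (0 : ℝ)..y, deriv u₀ z = u₀ y := fun y hy => by
    have h1 : AbsolutelyContinuousOnInterval u₀ 0 y := h.memH1.2.1.mono (by
      rw [uIcc_of_le hy.1, uIcc_of_le zero_le_one]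
      exact Icc_subset_Icc_right hy.2)
    rw [h1.integral_deriv_eq_sub, h.zero, sub_zero]
  -- The derivative has mean zero over a period, so its primitive is periodic and the identity on
  -- [0, 1] extends to the line.
  have hper : Function.Periodic (fun x => ∫ y in (0 : ℝ)..x, deriv u₀ y) 1 := fun y => by
    have h1 : u₀ 1 = 0 := by simpa [h.zero] using h.periodic_u 0
    have h2 := h.periodic_deriv.intervalIntegral_add_eq y 0
    rw [zero_add, hI 1 ⟨zero_le_one, le_rfl⟩, h1] at h2
    simp only
    rw [← intervalIntegral.integral_add_adjacent_intervals (h.intervalIntegrable_deriv 0 y)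
      (h.intervalIntegrable_deriv y (y + 1)), h2, add_zero]
  obtain ⟨y, hy, hxy⟩ := (hper.sub h.periodic_u).exists_mem_Ico₀ one_pos x
  have h1 := hI y (Ico_subset_Icc_self hy)
  simp only [Pi.sub_apply, h1, sub_self] at hxy
  linarith

theorem continuous_u : Continuous u₀ := by
  rw [show u₀ = fun x => ∫ y in (0 : ℝ)..x, deriv u₀ y from funext fun x => (h.integral_deriv x).symm]
  exact intervalIntegral.continuous_primitive h.intervalIntegrable_deriv 0

theorem continuous_cumEnergy : Continuous (cumEnergy u₀ ρ₀) :=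
  intervalIntegral.continuous_primitive h.intervalIntegrable_energy 0

theorem cumEnergy_one : cumEnergy u₀ ρ₀ 1 = 4 := by
  rw [← h.energy, cumEnergy, intervalIntegral.integral_add (h.intervalIntegrable_deriv_sq 0 1)
    (h.intervalIntegrable_ρ_sq 0 1), intervalIntegral.integral_of_le zero_le_one,
    intervalIntegral.integral_of_le zero_le_one]
  rfl

theorem cumEnergy_add_one (x : ℝ) : cumEnergy u₀ ρ₀ (x + 1) = cumEnergy u₀ ρ₀ x + 4 := by
  have hper : Function.Periodic (fun x => deriv u₀ x ^ 2 + ρ₀ x ^ 2) 1 := fun x => by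
    simp only [h.periodic_deriv x, h.periodic_ρ x]
  have h2 := hper.intervalIntegral_add_eq x 0
  rw [zero_add, show ∫ x in (0 : ℝ)..1, (deriv u₀ x ^ 2 + ρ₀ x ^ 2) = 4 from h.cumEnergy_one] at h2
  rw [← h2, cumEnergy, cumEnergy, intervalIntegral.integral_add_adjacent_intervals
    (h.intervalIntegrable_energy _ _) (h.intervalIntegrable_energy _ _)]

theorem cumEnergy_mem {x : ℝ} (hx : x ∈ Icc (0 : ℝ) 1) : cumEnergy u₀ ρ₀ x ∈ Icc (0 : ℝ) 4 := by
  have hm := monotone_of_primitive (fun x => by positivity) h.intervalIntegrable_energy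
    (Φ := cumEnergy u₀ ρ₀) fun x => rfl
  constructor
  · simpa [cumEnergy] using hm hx.1
  · rw [← h.cumEnergy_one]
    exact hm hx.2

theorem geoPhi_eq (t x : ℝ) : geoPhi u₀ ρ₀ t x = Real.cos t ^ 2 * x +
    Real.sin t * Real.cos t * u₀ x + Real.sin t ^ 2 / 4 * cumEnergy u₀ ρ₀ x := by
  unfold geoPhi cumEnergy
  rw [show geoPhiX u₀ ρ₀ t = _ from funext (geoPhiX_eq t), intervalIntegral.integral_add
    (intervalIntegrable_const.add ((h.intervalIntegrable_deriv 0 x).const_mul _))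
    ((h.intervalIntegrable_energy 0 x).const_mul _), intervalIntegral.integral_add
    intervalIntegrable_const ((h.intervalIntegrable_deriv 0 x).const_mul _),
    intervalIntegral.integral_const_mul, intervalIntegral.integral_const_mul, h.integral_deriv]
  simp [mul_comm]

theorem integral_geoPhiTX (t x : ℝ) : ∫ y in (0 : ℝ)..x, geoPhiTX u₀ ρ₀ t y =
    geoPhiT u₀ ρ₀ t x := by
  unfold geoPhiTX geoPhiT cumEnergy
  rw [intervalIntegral.integral_add
    (intervalIntegrable_const.add ((h.intervalIntegrable_deriv 0 x).const_mul _))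
    ((h.intervalIntegrable_energy 0 x).const_mul _), intervalIntegral.integral_add
    intervalIntegrable_const ((h.intervalIntegrable_deriv 0 x).const_mul _),
    intervalIntegral.integral_const,
    intervalIntegral.integral_const_mul, intervalIntegral.integral_const_mul, h.integral_deriv]
  simp only [sub_zero, smul_eq_mul]
  ring

theorem integral_geoQ (t x : ℝ) : ∫ y in (0 : ℝ)..x, geoQ u₀ ρ₀ t y = Real.sin t ^ 2 * x -
    Real.sin t * Real.cos t * u₀ x + Real.cos t ^ 2 / 4 * cumEnergy u₀ ρ₀ x := by
  unfold cumEnergy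
  rw [show geoQ u₀ ρ₀ t = _ from funext (geoQ_eq t), intervalIntegral.integral_add
    (intervalIntegrable_const.sub ((h.intervalIntegrable_deriv 0 x).const_mul _))
    ((h.intervalIntegrable_energy 0 x).const_mul _), intervalIntegral.integral_sub
    intervalIntegrable_const ((h.intervalIntegrable_deriv 0 x).const_mul _),
    intervalIntegral.integral_const_mul, intervalIntegral.integral_const_mul, h.integral_deriv]
  simp [mul_comm]

theorem hasDerivAt_geoPhi (t x : ℝ) :
    HasDerivAt (fun s => geoPhi u₀ ρ₀ s x) (geoPhiT u₀ ρ₀ t x) t := by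
  simp only [h.geoPhi_eq]
  have hs := Real.hasDerivAt_sin t
  have hc := Real.hasDerivAt_cos t
  refine ((((hc.pow 2).mul_const x).add ((hs.mul hc).mul_const (u₀ x))).add
    (((hs.pow 2).div_const 4).mul_const (cumEnergy u₀ ρ₀ x))).congr_deriv ?_
  unfold geoPhiT
  push_cast
  ring

omit h in
theorem hasDerivAt_geoPhiT (t x : ℝ) :
    HasDerivAt (fun s => geoPhiT u₀ ρ₀ s x) (geoPhiTT u₀ ρ₀ t x) t := by
  unfold geoPhiT
  have hs := Real.hasDerivAt_sin t
  have hc := Real.hasDerivAt_cos t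
  refine ((((((hs.const_mul (-2)).mul hc).mul_const x)).add
    (((hc.pow 2).sub (hs.pow 2)).mul_const (u₀ x))).add
    (((hs.mul hc).div_const 2).mul_const (cumEnergy u₀ ρ₀ x))).congr_deriv ?_
  unfold geoPhiTT
  push_cast
  ring

omit h in
theorem hasDerivAt_geoPhiX (t x : ℝ) :
    HasDerivAt (fun s => geoPhiX u₀ ρ₀ s x) (geoPhiTX u₀ ρ₀ t x) t := by
  simp only [geoPhiX_eq]
  have hs := Real.hasDerivAt_sin t
  have hc := Real.hasDerivAt_cos t
  refine (((hc.pow 2).add ((hs.mul hc).mul_const (deriv u₀ x))).add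
    (((hs.pow 2).div_const 4).mul_const (deriv u₀ x ^ 2 + ρ₀ x ^ 2))).congr_deriv ?_
  unfold geoPhiTX
  push_cast
  ring

/-- The normalisation of the energy to 4 enters here: over one period φ grows by cos² t + (sin² t /
4) · 4 = 1. -/
theorem geoPhi_add_one (t x : ℝ) : geoPhi u₀ ρ₀ t (x + 1) = geoPhi u₀ ρ₀ t x + 1 := by
  rw [h.geoPhi_eq, h.geoPhi_eq, h.periodic_u, h.cumEnergy_add_one]
  linear_combination Real.sin_sq_add_cos_sq t

theorem geoPhiT_add_one (t x : ℝ) : geoPhiT u₀ ρ₀ t (x + 1) = geoPhiT u₀ ρ₀ t x := by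
  unfold geoPhiT
  rw [h.periodic_u, h.cumEnergy_add_one]
  ring

omit h in
theorem geoPhi_zero (t : ℝ) : geoPhi u₀ ρ₀ t 0 = 0 := by simp [geoPhi]

theorem geoPhi_one (t : ℝ) : geoPhi u₀ ρ₀ t 1 = 1 := by
  simpa [geoPhi_zero] using h.geoPhi_add_one t 0

theorem monotone_geoPhi (t : ℝ) : Monotone (geoPhi u₀ ρ₀ t) :=
  monotone_of_primitive (geoPhiX_nonneg t) (h.intervalIntegrable_geoPhiX t) fun _ => rfl

theorem continuous_geoPhi (t : ℝ) : Continuous (geoPhi u₀ ρ₀ t) :=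
  continuous_of_primitive (h.intervalIntegrable_geoPhiX t) fun _ => rfl

theorem continuous_uncurry_geoPhi : Continuous (Function.uncurry (geoPhi u₀ ρ₀)) := by
  have h1 := h.continuous_u
  have h2 := h.continuous_cumEnergy
  unfold Function.uncurry
  simp only [h.geoPhi_eq]
  fun_prop

theorem continuous_uncurry_geoPhiT : Continuous (Function.uncurry (geoPhiT u₀ ρ₀)) := by
  have h1 := h.continuous_u
  have h2 := h.continuous_cumEnergy
  unfold Function.uncurry geoPhiT
  fun_prop

theorem continuous_geoPhiT (t : ℝ) : Continuous (geoPhiT u₀ ρ₀ t) := by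
  have h1 := h.continuous_u
  have h2 := h.continuous_cumEnergy
  unfold geoPhiT
  fun_prop

theorem continuous_geoPhiTT (t : ℝ) : Continuous (geoPhiTT u₀ ρ₀ t) := by
  have h1 := h.continuous_u
  have h2 := h.continuous_cumEnergy
  unfold geoPhiTT
  fun_prop

theorem geoPhi_mem {t x : ℝ} (hx : x ∈ Icc (0 : ℝ) 1) : geoPhi u₀ ρ₀ t x ∈ Icc (0 : ℝ) 1 := by
  constructor
  · simpa [geoPhi_zero] using h.monotone_geoPhi t hx.1
  · simpa [h.geoPhi_one] using h.monotone_geoPhi t hx.2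

theorem abs_geoPhi_sub_le (t x : ℝ) : |geoPhi u₀ ρ₀ t x - x| ≤ 1 := by
  have hper : Function.Periodic (fun x => geoPhi u₀ ρ₀ t x - x) 1 := fun x => by
    simp only [h.geoPhi_add_one]; ring
  obtain ⟨y, hy, hxy⟩ := hper.exists_mem_Ico₀ one_pos x
  have := h.geoPhi_mem (t := t) (Ico_subset_Icc_self hy)
  rw [hxy, abs_le]
  constructor <;> linarith [this.1, this.2, hy.1, hy.2]

theorem surjective_geoPhi (t : ℝ) : Function.Surjective (geoPhi u₀ ρ₀ t) := by
  refine (h.continuous_geoPhi t).surjective ?_ ?_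
  · refine tendsto_atTop_mono (fun x => ?_) (tendsto_atTop_add_const_right _ (-1 : ℝ) tendsto_id)
    have := abs_le.1 (h.abs_geoPhi_sub_le t x)
    simp only [id]; linarith
  · refine tendsto_atBot_mono (fun x => ?_) (tendsto_atBot_add_const_right _ (1 : ℝ) tendsto_id)
    have := abs_le.1 (h.abs_geoPhi_sub_le t x)
    simp only [id]; linarith

theorem exists_geoPhi_eq (t : ℝ) {y : ℝ} (hy : y ∈ Icc (0 : ℝ) 1) :
    ∃ x ∈ Icc (0 : ℝ) 1, geoPhi u₀ ρ₀ t x = y := by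
  have := intermediate_value_Icc zero_le_one (h.continuous_geoPhi t).continuousOn
  rw [geoPhi_zero, h.geoPhi_one] at this
  exact this hy

/-- `φ_t` is constant on the fibres of `φ`. -/
theorem geoPhiT_eq_of_geoPhi_eq {t x y : ℝ} (hxy : geoPhi u₀ ρ₀ t x = geoPhi u₀ ρ₀ t y) :
    geoPhiT u₀ ρ₀ t x = geoPhiT u₀ ρ₀ t y := by
  wlog hle : x ≤ y generalizing x y
  · exact (this hxy.symm (le_of_not_ge hle)).symm
  have h1 := sub_eq_integral_of_primitive (h.intervalIntegrable_geoPhiX t)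
    (Φ := geoPhi u₀ ρ₀ t) (fun _ => rfl) x y
  have h2 := sub_eq_integral_of_primitive (h.intervalIntegrable_geoPhiTX t)
    (Φ := geoPhiT u₀ ρ₀ t) (fun x => (h.integral_geoPhiTX t x).symm) x y
  rw [hxy, sub_self] at h1
  have h3 := (intervalIntegral.integral_eq_zero_iff_of_le_of_nonneg_ae hle
    (ae_of_all _ fun z => geoPhiX_nonneg t z) (h.intervalIntegrable_geoPhiX t x y)).1 h1.symm
  have h4 : ∫ z in x..y, geoPhiTX u₀ ρ₀ t z = 0 := by
    rw [intervalIntegral.integral_of_le hle]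
    exact integral_eq_zero_of_ae (h3.mono fun z hz => geoPhiTX_eq_zero hz)
  linarith

end IsUnitData

/-! ### States of the flow at a fixed time: existence and transfer of null sets through φ. -/

theorem ae_of_forall_ae_Ioc {q : ℝ → Prop}
    (h : ∀ c d : ℝ, c ≤ d → ∀ᵐ x ∂(volume.restrict (Ioc c d)), q x) : ∀ᵐ x, q x := by
  rw [← Measure.restrict_univ (μ := (volume : Measure ℝ)), ← iUnion_Ioc_intCast ℝ,
    ae_restrict_iUnion_iff]
  exact fun n => h _ _ (by linarith)

theorem normA_sq (v r : ℝ → ℝ) : normA v r ^ 2 = 1 / 4 * (normSq (deriv v) + normSq r) := by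
  have : 0 ≤ normSq (deriv v) + normSq r :=
    add_nonneg (integral_nonneg fun _ => sq_nonneg _) (integral_nonneg fun _ => sq_nonneg _)
  rw [normA, mul_pow, Real.sq_sqrt this]
  norm_num

/-- The pair `(v, r)` of functions on the circle is the state at time `t` of the flow. -/
structure IsFlowAt (u₀ ρ₀ : ℝ → ℝ) (t : ℝ) (v r : ℝ → ℝ) : Prop where
  periodic_u : Function.Periodic v 1
  periodic_ρ : Function.Periodic r 1
  comp_u : ∀ x, v (geoPhi u₀ ρ₀ t x) = geoPhiT u₀ ρ₀ t x
  comp_ρ : ∀ᵐ x, r (geoPhi u₀ ρ₀ t x) = ρ₀ x / geoPhiX u₀ ρ₀ t x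

namespace IsUnitData

variable (h : IsUnitData u₀ ρ₀)
include h

/-- `C` is the set of plateau heights, countable because φ is monotone, and `ψ` is a right inverse,
automatically monotone and hence measurable. A countable set is Lebesgue-null, so its preimage has
no φ_x dx mass: φ_x = 0 almost everywhere on it. -/
theorem measurable_section_geoPhi (t : ℝ) : ∃ (ψ : ℝ → ℝ) (C : Set ℝ), Measurable ψ ∧
    MeasurableSet C ∧ (∀ y, y + 1 ∈ C ↔ y ∈ C) ∧ (∀ y, y ∉ C → ψ (y + 1) = ψ y + 1) ∧
    (∀ y, geoPhi u₀ ρ₀ t (ψ y) = y) ∧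
    (∀ x, geoPhi u₀ ρ₀ t x ∉ C → ψ (geoPhi u₀ ρ₀ t x) = x) ∧
    ∀ᵐ x, geoPhi u₀ ρ₀ t x ∈ C → geoPhiX u₀ ρ₀ t x = 0 := by
  set Φ := geoPhi u₀ ρ₀ t
  have hmono : Monotone Φ := h.monotone_geoPhi t
  let ψ := Function.surjInv (h.surjective_geoPhi t)
  have hψ : ∀ y, Φ (ψ y) = y := Function.surjInv_eq (h.surjective_geoPhi t)
  let C := {c | ∃ x y, x < y ∧ Φ x = c ∧ Φ y = c}
  have hC : C.Countable := hmono.countable_setOfPred_two_preimages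
  have hinj : ∀ x y, Φ x = Φ y → Φ x ∉ C → x = y := fun x y hxy hx => by
    by_contra hne
    rcases lt_or_gt_of_ne hne with hlt | hlt
    · exact hx ⟨x, y, hlt, rfl, hxy.symm⟩
    · exact hx ⟨y, x, hlt, hxy.symm, rfl⟩
  have hC1 : ∀ y, y + 1 ∈ C ↔ y ∈ C := fun y => by
    constructor
    · rintro ⟨a, b, hab, ha, hb⟩
      refine ⟨a - 1, b - 1, by linarith, ?_, ?_⟩
      · have := h.geoPhi_add_one t (a - 1)
        rw [sub_add_cancel] at this
        linarith
      · have := h.geoPhi_add_one t (b - 1)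
        rw [sub_add_cancel] at this
        linarith
    · rintro ⟨a, b, hab, ha, hb⟩
      refine ⟨a + 1, b + 1, by linarith, ?_, ?_⟩
      · rw [← ha]; exact h.geoPhi_add_one t a
      · rw [← hb]; exact h.geoPhi_add_one t b
  have hψm : Monotone ψ := fun x y hxy => by
    by_contra hlt
    have h1 := hmono (not_le.1 hlt).le
    rw [hψ, hψ] at h1
    have h2 := le_antisymm hxy h1
    subst h2
    exact hlt le_rfl
  refine ⟨ψ, C, hψm.measurable, hC.measurableSet, hC1, fun y hy => ?_, hψ, fun x hx => ?_, ?_⟩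
  · refine hinj _ _ ?_ ?_
    · rw [hψ]
      refine Eq.trans ?_ (h.geoPhi_add_one t (ψ y)).symm
      rw [show geoPhi u₀ ρ₀ t (ψ y) = y from hψ y]
    · rwa [hψ, hC1]
  · exact hinj _ _ (hψ _) (by rwa [hψ])
  · refine ae_of_forall_ae_Ioc fun c d hcd => ?_
    have h1 : ∀ᵐ y ∂(volume.restrict (Ioc (Φ c) (Φ d))), y ∉ C :=
      ae_restrict_of_ae (hC.ae_notMem volume)
    filter_upwards [ae_comp_primitive_of_ae (geoPhiX_nonneg t) (h.intervalIntegrable_geoPhiX t)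
      (Φ := Φ) (fun _ => rfl) hcd h1] with x hx hxC
    by_contra hp
    exact hx hp hxC

/-- Read φ_t and ρ₀/φ_x along the section. On plateau heights the section need not commute with the
shift by 1, so the density is set to 0 there to keep it periodic. -/
theorem exists_isFlowAt (t : ℝ) : ∃ v r, IsFlowAt u₀ ρ₀ t v r := by
  classical
  obtain ⟨ψ, C, -, -, hC1, hψ1, hψ, hψ', hC⟩ := h.measurable_section_geoPhi t
  refine ⟨fun y => geoPhiT u₀ ρ₀ t (ψ y),
    fun y => if y ∈ C then 0 else ρ₀ (ψ y) / geoPhiX u₀ ρ₀ t (ψ y), fun y => ?_, fun y => ?_,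
    fun x => ?_, ?_⟩
  · rw [← h.geoPhiT_add_one t (ψ y)]
    refine h.geoPhiT_eq_of_geoPhi_eq ?_
    rw [hψ, h.geoPhi_add_one, hψ]
  · by_cases hy : y ∈ C
    · simp only [hC1, hy, if_true]
    · have : geoPhiX u₀ ρ₀ t (ψ y + 1) = geoPhiX u₀ ρ₀ t (ψ y) := by
        rw [geoPhiX_eq, geoPhiX_eq, h.periodic_deriv, h.periodic_ρ]
      simp only [hC1, hy, if_false, hψ1 y hy, h.periodic_ρ (ψ y), this]
  · exact h.geoPhiT_eq_of_geoPhi_eq (hψ _)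
  · filter_upwards [hC] with x hx
    by_cases hy : geoPhi u₀ ρ₀ t x ∈ C
    -- Division by zero returns 0, which agrees with the value chosen on `C`.
    · rw [if_pos hy, hx hy, div_zero]
    · rw [if_neg hy, hψ' x hy]

/-- Every measurable function of `x` is a measurable function of `φ(t,x)` where `φₓ > 0`. -/
theorem exists_measurable_comp_geoPhi_eq (t : ℝ) {β : ℝ → ℝ} (hβ : AEMeasurable β) :
    ∃ w : ℝ → ℝ, Measurable w ∧
      ∀ᵐ x, geoPhiX u₀ ρ₀ t x ≠ 0 → w (geoPhi u₀ ρ₀ t x) = β x := by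
  obtain ⟨ψ, C, hψm, -, -, -, -, hψ, hC⟩ := h.measurable_section_geoPhi t
  refine ⟨fun y => hβ.mk β (ψ y), hβ.measurable_mk.comp hψm, ?_⟩
  filter_upwards [hC, hβ.ae_eq_mk] with x hx hx' hp
  rw [hψ x fun hxC => hp (hx hxC), hx']

theorem aemeasurable_ρ : AEMeasurable ρ₀ := by
  have : LocallyIntegrable ρ₀ := fun x =>
    ⟨Icc (x - 1) (x + 1), Icc_mem_nhds (by linarith) (by linarith),
      (intervalIntegrable_iff_integrableOn_Icc_of_le (by linarith)).1
        (h.intervalIntegrable_ρ (x - 1) (x + 1))⟩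
  exact this.aestronglyMeasurable.aemeasurable

theorem aemeasurable_geoPhiX (t : ℝ) : AEMeasurable (geoPhiX u₀ ρ₀ t) := by
  have h1 := h.aemeasurable_ρ
  have h2 := measurable_deriv u₀
  unfold geoPhiX geoF geoG
  fun_prop

theorem aemeasurable_geoPhiTX (t : ℝ) : AEMeasurable (geoPhiTX u₀ ρ₀ t) := by
  have h1 := h.aemeasurable_ρ
  have h2 := measurable_deriv u₀
  unfold geoPhiTX
  fun_prop

theorem aemeasurable_geoQ (t : ℝ) : AEMeasurable (geoQ u₀ ρ₀ t) := by
  have h1 := h.aemeasurable_ρ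
  have h2 := measurable_deriv u₀
  unfold geoQ
  fun_prop

theorem integral_comp_geoPhi (t : ℝ) {c d : ℝ} (hcd : c ≤ d) {k : ℝ → ℝ}
    (hk : AEStronglyMeasurable k
      (volume.restrict (Ioc (geoPhi u₀ ρ₀ t c) (geoPhi u₀ ρ₀ t d)))) :
    ∫ y in geoPhi u₀ ρ₀ t c..geoPhi u₀ ρ₀ t d, k y =
      ∫ x in c..d, k (geoPhi u₀ ρ₀ t x) * geoPhiX u₀ ρ₀ t x :=
  integral_comp_primitive (geoPhiX_nonneg t) (h.intervalIntegrable_geoPhiX t)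
    (fun _ => rfl) hcd hk

theorem intervalIntegrable_comp_geoPhi_iff (t : ℝ) {c d : ℝ} (hcd : c ≤ d) {k : ℝ → ℝ}
    (hk : AEStronglyMeasurable k
      (volume.restrict (Ioc (geoPhi u₀ ρ₀ t c) (geoPhi u₀ ρ₀ t d)))) :
    IntervalIntegrable k volume (geoPhi u₀ ρ₀ t c) (geoPhi u₀ ρ₀ t d) ↔
      IntervalIntegrable (fun x => k (geoPhi u₀ ρ₀ t x) * geoPhiX u₀ ρ₀ t x) volume c d := by
  have hpi := h.intervalIntegrable_geoPhiX t
  rw [intervalIntegrable_iff_integrableOn_Ioc_of_le (h.monotone_geoPhi t hcd), IntegrableOn,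
    ← map_densityOn (geoPhiX_nonneg t) hpi (Φ := geoPhi u₀ ρ₀ t) (fun _ => rfl) hcd,
    integrable_map_measure _ (h.continuous_geoPhi t).aemeasurable,
    integrable_densityOn_iff hpi (geoPhiX_nonneg t) hcd]
  · rfl
  · rwa [map_densityOn (geoPhiX_nonneg t) hpi (Φ := geoPhi u₀ ρ₀ t) (fun _ => rfl) hcd]

theorem ae_of_ae_comp_geoPhi (t : ℝ) {c d : ℝ} (hcd : c ≤ d) {q : ℝ → Prop}
    (hq : ∀ᵐ x, geoPhiX u₀ ρ₀ t x ≠ 0 → q (geoPhi u₀ ρ₀ t x)) :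
    ∀ᵐ y ∂(volume.restrict (Ioc (geoPhi u₀ ρ₀ t c) (geoPhi u₀ ρ₀ t d))), q y :=
  ae_of_ae_comp_primitive (geoPhiX_nonneg t) (h.intervalIntegrable_geoPhiX t)
    (fun _ => rfl) hcd (ae_restrict_of_ae hq)

theorem ae_iff_ae_comp_geoPhi (t : ℝ) {q : ℝ → Prop} :
    (∀ᵐ y, q y) ↔ ∀ᵐ x, geoPhiX u₀ ρ₀ t x ≠ 0 → q (geoPhi u₀ ρ₀ t x) := by
  constructor
  · intro hq
    exact ae_of_forall_ae_Ioc fun c d hcd => ae_comp_primitive_of_ae (geoPhiX_nonneg t)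
      (h.intervalIntegrable_geoPhiX t) (fun _ => rfl) hcd (ae_restrict_of_ae hq)
  · intro hq
    refine ae_of_forall_ae_Ioc fun c d hcd => ?_
    obtain ⟨c', rfl⟩ := h.surjective_geoPhi t c
    obtain ⟨d', rfl⟩ := h.surjective_geoPhi t d
    rcases le_total c' d' with hle | hle
    · exact h.ae_of_ae_comp_geoPhi t hle hq
    · rw [Ioc_eq_empty_of_le (h.monotone_geoPhi t hle)]
      simp

/-- The part of `f_t² + g_t²` where `φₓ > 0`. -/
theorem intervalIntegrable_indicator_geoQ (t c d : ℝ) :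
    IntervalIntegrable (indicator {x | geoPhiX u₀ ρ₀ t x ≠ 0} fun x => 4 * geoQ u₀ ρ₀ t x)
      volume c d := by
  have hm : NullMeasurableSet {x | geoPhiX u₀ ρ₀ t x ≠ 0} volume :=
    (h.aemeasurable_geoPhiX t).nullMeasurableSet_preimage (measurableSet_singleton 0).compl
  refine ((h.intervalIntegrable_geoQ t c d).const_mul 4).mono_fun' ?_ ?_
  · exact (((h.aemeasurable_geoQ t).const_mul 4).indicator₀ hm).restrict.aestronglyMeasurable
  · refine ae_of_all _ fun x => ?_
    have := geoQ_nonneg (u₀ := u₀) (ρ₀ := ρ₀) t x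
    simp only [indicator]
    split_ifs
    · rw [Real.norm_of_nonneg (by positivity)]
    · simpa using this

end IsUnitData

/-! ### Regularity and energy of a state of the flow. -/

namespace IsFlowAt

variable {t : ℝ} {v r : ℝ → ℝ} (hf : IsFlowAt u₀ ρ₀ t v r) (h : IsUnitData u₀ ρ₀)
include h hf

theorem aemeasurable_ρ : AEMeasurable r := by
  obtain ⟨w, hw, hw'⟩ := h.exists_measurable_comp_geoPhi_eq t
    (h.aemeasurable_ρ.div (h.aemeasurable_geoPhiX t))
  refine ⟨w, hw, (h.ae_iff_ae_comp_geoPhi t).2 ?_⟩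
  filter_upwards [hw', hf.comp_ρ] with x h1 h2 hp
  rw [h1 hp, h2, Pi.div_apply]

/-- `v` is the primitive of a function `w` with `w ∘ φ = φ_tx / φₓ`. -/
theorem exists_primitive : ∃ w : ℝ → ℝ, (∀ c d, IntervalIntegrable w volume c d) ∧
    (∀ y, v y = ∫ z in (0 : ℝ)..y, w z) ∧ ∀ᵐ x, geoPhiX u₀ ρ₀ t x ≠ 0 →
      w (geoPhi u₀ ρ₀ t x) = geoPhiTX u₀ ρ₀ t x / geoPhiX u₀ ρ₀ t x := by
  obtain ⟨w, hw, hw'⟩ := h.exists_measurable_comp_geoPhi_eq t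
    ((h.aemeasurable_geoPhiTX t).div (h.aemeasurable_geoPhiX t))
  have hmul : (fun x => w (geoPhi u₀ ρ₀ t x) * geoPhiX u₀ ρ₀ t x) =ᵐ[volume]
      geoPhiTX u₀ ρ₀ t := by
    filter_upwards [hw'] with x hx
    by_cases hp : geoPhiX u₀ ρ₀ t x = 0
    · rw [hp, geoPhiTX_eq_zero hp, mul_zero]
    · rw [hx hp, Pi.div_apply, div_mul_cancel₀ _ hp]
  have hle : ∀ c d, c ≤ d →
      IntervalIntegrable w volume (geoPhi u₀ ρ₀ t c) (geoPhi u₀ ρ₀ t d) ∧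
      v (geoPhi u₀ ρ₀ t d) - v (geoPhi u₀ ρ₀ t c) =
        ∫ z in geoPhi u₀ ρ₀ t c..geoPhi u₀ ρ₀ t d, w z := fun c d hcd => by
    refine ⟨(h.intervalIntegrable_comp_geoPhi_iff t hcd hw.aestronglyMeasurable).2
      ((h.intervalIntegrable_geoPhiTX t c d).congr_ae (ae_restrict_of_ae hmul.symm)), ?_⟩
    rw [h.integral_comp_geoPhi t hcd hw.aestronglyMeasurable, hf.comp_u, hf.comp_u,
      sub_eq_integral_of_primitive (h.intervalIntegrable_geoPhiTX t)
        (Φ := geoPhiT u₀ ρ₀ t) (fun x => (h.integral_geoPhiTX t x).symm)]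
    exact intervalIntegral.integral_congr_ae (hmul.symm.mono fun x hx _ => hx)
  have hint : ∀ c d, IntervalIntegrable w volume c d := fun c d => by
    obtain ⟨c', rfl⟩ := h.surjective_geoPhi t c
    obtain ⟨d', rfl⟩ := h.surjective_geoPhi t d
    rcases le_total c' d' with hcd | hcd
    · exact (hle _ _ hcd).1
    · exact (hle _ _ hcd).1.symm
  refine ⟨w, hint, fun y => ?_, hw'⟩
  have hv0 : v 0 = 0 := by
    have := hf.comp_u 0
    rwa [IsUnitData.geoPhi_zero, geoPhiT, h.zero, cumEnergy, intervalIntegral.integral_same,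
      mul_zero, mul_zero, mul_zero, add_zero, add_zero] at this
  obtain ⟨y', rfl⟩ := h.surjective_geoPhi t y
  rcases le_total 0 y' with hcd | hcd
  · have := (hle _ _ hcd).2
    rwa [IsUnitData.geoPhi_zero, hv0, sub_zero] at this
  · have := (hle _ _ hcd).2
    rw [IsUnitData.geoPhi_zero, hv0, zero_sub] at this
    rw [intervalIntegral.integral_symm, ← this, neg_neg]

/-- Lebesgue differentiation identifies the derivative of v with its density `w` almost everywhere,
and this passes through φ where φ_x ≠ 0. -/
theorem comp_deriv : ∀ᵐ x, geoPhiX u₀ ρ₀ t x ≠ 0 →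
    deriv v (geoPhi u₀ ρ₀ t x) = geoPhiTX u₀ ρ₀ t x / geoPhiX u₀ ρ₀ t x := by
  obtain ⟨w, hint, hv, hw⟩ := hf.exists_primitive h
  have hloc : LocallyIntegrable w := fun x =>
    ⟨Icc (x - 1) (x + 1), Icc_mem_nhds (by linarith) (by linarith),
      (intervalIntegrable_iff_integrableOn_Icc_of_le (by linarith)).1 (hint (x - 1) (x + 1))⟩
  have hd : ∀ᵐ y, deriv v y = w y := by
    filter_upwards [LocallyIntegrable.ae_hasDerivAt_integral hloc] with y hy
    rw [show v = _ from funext hv]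
    exact (hy 0).deriv
  filter_upwards [(h.ae_iff_ae_comp_geoPhi t).1 hd, hw] with x h1 h2 hp
  rw [h1 hp, h2 hp]

theorem absolutelyContinuous : AbsolutelyContinuousOnInterval v 0 1 := by
  obtain ⟨w, hint, hv, -⟩ := hf.exists_primitive h
  rw [show v = _ from funext hv]
  exact (hint 0 1).absolutelyContinuousOnInterval_intervalIntegral (by simp)

theorem continuous_u : Continuous v := by
  obtain ⟨w, hint, hv, -⟩ := hf.exists_primitive h
  rw [show v = _ from funext hv]
  exact intervalIntegral.continuous_primitive hint 0

/-- Lagrange's identity divided by φ_x. On the zero set of φ_x the Jacobian erases the contribution,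
which is the only mechanism of energy loss. -/
theorem comp_energy : (fun x => (deriv v (geoPhi u₀ ρ₀ t x) ^ 2 + r (geoPhi u₀ ρ₀ t x) ^ 2) *
    geoPhiX u₀ ρ₀ t x) =ᵐ[volume]
      indicator {x | geoPhiX u₀ ρ₀ t x ≠ 0} fun x => 4 * geoQ u₀ ρ₀ t x := by
  filter_upwards [hf.comp_deriv h, hf.comp_ρ] with x h1 h2
  by_cases hp : geoPhiX u₀ ρ₀ t x = 0
  · simp [hp]
  · rw [indicator_of_mem (by exact hp), h1 hp, h2]
    have := geoPhiTX_sq_add_sq (u₀ := u₀) (ρ₀ := ρ₀) t x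
    field_simp
    linarith

theorem aestronglyMeasurable_energy :
    AEStronglyMeasurable (fun y => deriv v y ^ 2 + r y ^ 2) volume := by
  have h1 := hf.aemeasurable_ρ h
  have h2 := measurable_deriv v
  exact ((h2.pow_const 2).aemeasurable.add (h1.pow_const 2)).aestronglyMeasurable

theorem intervalIntegrable_energy :
    IntervalIntegrable (fun y => deriv v y ^ 2 + r y ^ 2) volume 0 1 := by
  have := (h.intervalIntegrable_comp_geoPhi_iff t zero_le_one
    (hf.aestronglyMeasurable_energy h).restrict).2
    ((h.intervalIntegrable_indicator_geoQ t 0 1).congr_ae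
      (ae_restrict_of_ae (hf.comp_energy h).symm))
  rwa [IsUnitData.geoPhi_zero, h.geoPhi_one] at this

theorem continuous_integral_energy :
    Continuous fun x => ∫ y in (0 : ℝ)..x, (deriv v y ^ 2 + r y ^ 2) := by
  refine intervalIntegral.continuous_primitive (fun c d => ?_) 0
  refine Function.Periodic.intervalIntegrable₀ (fun x => ?_) one_ne_zero
    (hf.intervalIntegrable_energy h) c d
  have h1 : deriv v (x + 1) = deriv v x := by
    rw [← deriv_comp_add_const]
    congr 1
    exact funext hf.periodic_u
  simp only [h1, hf.periodic_ρ x]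

theorem integral_energy {x : ℝ} (hx : 0 ≤ x) :
    ∫ y in (0 : ℝ)..geoPhi u₀ ρ₀ t x, (deriv v y ^ 2 + r y ^ 2) =
      ∫ y in (0 : ℝ)..x, indicator {x | geoPhiX u₀ ρ₀ t x ≠ 0}
        (fun x => 4 * geoQ u₀ ρ₀ t x) y := by
  have := h.integral_comp_geoPhi t hx (hf.aestronglyMeasurable_energy h).restrict
  rw [IsUnitData.geoPhi_zero] at this
  rw [this]
  exact intervalIntegral.integral_congr_ae ((hf.comp_energy h).mono fun x hx _ => hx)

theorem memLp_deriv : MemLp (deriv v) 2 circleMeasure := by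
  rw [memLp_two_iff_integrable_sq (measurable_deriv v).aestronglyMeasurable]
  have := (intervalIntegrable_iff_integrableOn_Ioc_of_le zero_le_one).1
    (hf.intervalIntegrable_energy h)
  refine this.mono' ((measurable_deriv v).pow_const 2).aestronglyMeasurable (ae_of_all _ fun x => ?_)
  rw [Real.norm_of_nonneg (sq_nonneg _)]
  linarith [sq_nonneg (r x)]

theorem memLp_ρ : MemLp r 2 circleMeasure := by
  have hm := hf.aemeasurable_ρ h
  rw [memLp_two_iff_integrable_sq hm.restrict.aestronglyMeasurable]
  have := (intervalIntegrable_iff_integrableOn_Ioc_of_le zero_le_one).1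
    (hf.intervalIntegrable_energy h)
  refine this.mono' (hm.pow_const 2).restrict.aestronglyMeasurable (ae_of_all _ fun x => ?_)
  rw [Real.norm_of_nonneg (sq_nonneg _)]
  linarith [sq_nonneg (deriv v x)]

theorem memH1 : MemH1 v := ⟨hf.periodic_u, hf.absolutelyContinuous h, hf.memLp_deriv h⟩

theorem memL2 : MemL2 r := ⟨hf.periodic_ρ, hf.memLp_ρ h⟩

theorem normSq_add_normSq_eq_integral :
    normSq (deriv v) + normSq r = ∫ y in (0 : ℝ)..1, (deriv v y ^ 2 + r y ^ 2) := by
  rw [intervalIntegral.integral_of_le zero_le_one, normSq, normSq,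
    integral_add (hf.memLp_deriv h).integrable_sq (hf.memLp_ρ h).integrable_sq]

/-- The total integral of q over a period is sin² t + cos² t = 1, and the part over the zero set of
φ_x is missing from the pulled-back energy. -/
theorem normSq_add_normSq : normSq (deriv v) + normSq r = 4 - 4 *
    ∫ x in (0 : ℝ)..1, indicator {x | geoPhiX u₀ ρ₀ t x = 0} (geoQ u₀ ρ₀ t) x := by
  have h1 := hf.integral_energy h zero_le_one
  rw [h.geoPhi_one] at h1
  have h2 : ∫ x in (0 : ℝ)..1, geoQ u₀ ρ₀ t x = 1 := by
    have hu1 : u₀ 1 = 0 := by simpa [h.zero] using h.periodic_u 0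
    rw [h.integral_geoQ, hu1, h.cumEnergy_one]
    linear_combination Real.sin_sq_add_cos_sq t
  have h3 : indicator {x | geoPhiX u₀ ρ₀ t x = 0} (geoQ u₀ ρ₀ t) = fun x => geoQ u₀ ρ₀ t x -
      1 / 4 * indicator {x | geoPhiX u₀ ρ₀ t x ≠ 0} (fun x => 4 * geoQ u₀ ρ₀ t x) x := by
    funext x
    by_cases hp : geoPhiX u₀ ρ₀ t x = 0 <;> simp [indicator, hp]
  rw [hf.normSq_add_normSq_eq_integral h, h1, h3, intervalIntegral.integral_sub
    (h.intervalIntegrable_geoQ t 0 1) ((h.intervalIntegrable_indicator_geoQ t 0 1).const_mul _),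
    intervalIntegral.integral_const_mul, h2]
  ring

theorem normSq_add_normSq_le : normSq (deriv v) + normSq r ≤ 4 := by
  rw [hf.normSq_add_normSq h]
  have := intervalIntegral.integral_nonneg (μ := volume) zero_le_one fun x _ =>
    indicator_nonneg (s := {x | geoPhiX u₀ ρ₀ t x = 0}) (f := geoQ u₀ ρ₀ t)
      (fun x _ => geoQ_nonneg t x) x
  linarith

theorem normSq_add_normSq_of_sin_eq_zero (hs : Real.sin t = 0) :
    normSq (deriv v) + normSq r = 4 := by
  have : {x | geoPhiX u₀ ρ₀ t x = 0} = ∅ := by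
    ext x
    simp [geoPhiX_eq_zero_iff, hs]
  rw [hf.normSq_add_normSq h, this]
  simp

theorem normSq_add_normSq_of_sin_ne_zero (hs : Real.sin t ≠ 0) :
    normSq (deriv v) + normSq r = 4 - 4 / Real.sin t ^ 2 *
      circleMeasure.real ({x | deriv u₀ x = -2 * Real.cot t} ∩ {x | ρ₀ x = 0}) := by
  have hset : {x | geoPhiX u₀ ρ₀ t x = 0} =
      {x | deriv u₀ x = -2 * Real.cot t} ∩ {x | ρ₀ x = 0} := by
    ext x
    simp [geoPhiX_eq_zero_iff, hs]
  have hind : indicator {x | geoPhiX u₀ ρ₀ t x = 0} (geoQ u₀ ρ₀ t) =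
      indicator {x | geoPhiX u₀ ρ₀ t x = 0} fun _ => 1 / Real.sin t ^ 2 := by
    funext x
    by_cases hp : geoPhiX u₀ ρ₀ t x = 0
    · simp [indicator, hp, geoQ_of_geoPhiX_eq_zero hp]
    · simp [indicator, hp]
  have hm : NullMeasurableSet {x | geoPhiX u₀ ρ₀ t x = 0} circleMeasure :=
    (h.aemeasurable_geoPhiX t).restrict.nullMeasurableSet_preimage (measurableSet_singleton 0)
  rw [hf.normSq_add_normSq h, hind, intervalIntegral.integral_of_le zero_le_one,
    integral_indicator₀ hm, setIntegral_const, hset, smul_eq_mul]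
  ring

/-- Integration of `uₓ` against a function. -/
theorem integral_deriv_mul {θ : ℝ → ℝ} (hθ : Continuous θ) : ∫ y in (0 : ℝ)..1, deriv v y * θ y =
    ∫ x in (0 : ℝ)..1, geoPhiTX u₀ ρ₀ t x * θ (geoPhi u₀ ρ₀ t x) := by
  have := h.integral_comp_geoPhi t zero_le_one (k := fun y => deriv v y * θ y)
    ((measurable_deriv v).mul hθ.measurable).aestronglyMeasurable
  rw [IsUnitData.geoPhi_zero, h.geoPhi_one] at this
  rw [this]
  refine intervalIntegral.integral_congr_ae ?_
  filter_upwards [hf.comp_deriv h] with x hx _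
  by_cases hp : geoPhiX u₀ ρ₀ t x = 0
  · rw [hp, geoPhiTX_eq_zero hp]; ring
  · rw [hx hp]; field_simp

/-- Integration of `ρ` against a function. -/
theorem integral_ρ_mul {θ : ℝ → ℝ} (hθ : Continuous θ) : ∫ y in (0 : ℝ)..1, r y * θ y =
    ∫ x in (0 : ℝ)..1, ρ₀ x * θ (geoPhi u₀ ρ₀ t x) := by
  have := h.integral_comp_geoPhi t zero_le_one (k := fun y => r y * θ y)
    ((hf.aemeasurable_ρ h).mul hθ.aemeasurable).restrict.aestronglyMeasurable
  rw [IsUnitData.geoPhi_zero, h.geoPhi_one] at this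
  rw [this]
  refine intervalIntegral.integral_congr_ae ?_
  filter_upwards [hf.comp_ρ] with x hx _
  by_cases hp : geoPhiX u₀ ρ₀ t x = 0
  · rw [hp, density_eq_zero hp]; ring
  · rw [hx]; field_simp

end IsFlowAt

/-! ### The space `L²(𝕊)` -/

theorem toL2_eq {f : ℝ → ℝ} (hf : MemLp f 2 circleMeasure) : toL2 f = hf.toLp f := dif_pos hf

theorem coeFn_toL2 {f : ℝ → ℝ} (hf : MemLp f 2 circleMeasure) : toL2 f =ᵐ[circleMeasure] f := by
  rw [toL2_eq hf]
  exact hf.coeFn_toLp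

theorem toL2_sub {f g : ℝ → ℝ} (hf : MemLp f 2 circleMeasure) (hg : MemLp g 2 circleMeasure) :
    toL2 (fun x => f x - g x) = toL2 f - toL2 g := by
  rw [toL2_eq hf, toL2_eq hg]
  exact toL2_eq (hf.sub hg)

theorem toL2_add {f g : ℝ → ℝ} (hf : MemLp f 2 circleMeasure) (hg : MemLp g 2 circleMeasure) :
    toL2 (fun x => f x + g x) = toL2 f + toL2 g := by
  rw [toL2_eq hf, toL2_eq hg]
  exact toL2_eq (hf.add hg)

theorem toL2_smul (c : ℝ) {f : ℝ → ℝ} (hf : MemLp f 2 circleMeasure) :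
    toL2 (fun x => c * f x) = c • toL2 f := by
  rw [toL2_eq hf]
  exact toL2_eq (hf.const_smul c)

theorem inner_toL2_right (e : L2Circle) {g : ℝ → ℝ} (hg : MemLp g 2 circleMeasure) :
    inner ℝ e (toL2 g) = ∫ x in (0 : ℝ)..1, e x * g x := by
  rw [L2.inner_def, intervalIntegral.integral_of_le zero_le_one]
  refine integral_congr_ae ?_
  filter_upwards [coeFn_toL2 hg] with x hx
  rw [hx]
  simp [mul_comm]

theorem inner_toL2 {f g : ℝ → ℝ} (hf : MemLp f 2 circleMeasure) (hg : MemLp g 2 circleMeasure) :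
    inner ℝ (toL2 f) (toL2 g) = ∫ x in (0 : ℝ)..1, f x * g x := by
  rw [inner_toL2_right _ hg, intervalIntegral.integral_of_le zero_le_one,
    intervalIntegral.integral_of_le zero_le_one]
  refine integral_congr_ae ?_
  filter_upwards [coeFn_toL2 hf] with x hx
  rw [hx]

theorem norm_toL2_sq {f : ℝ → ℝ} (hf : MemLp f 2 circleMeasure) : ‖toL2 f‖ ^ 2 = normSq f := by
  rw [← real_inner_self_eq_norm_sq, inner_toL2 hf hf, normSq,
    intervalIntegral.integral_of_le zero_le_one]
  simp only [sq]

theorem memLp_of_continuous {f : ℝ → ℝ} (hf : Continuous f) : MemLp f 2 circleMeasure :=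
  ((memLp_two_iff_integrable_sq hf.aestronglyMeasurable).2
    ((intervalIntegrable_iff_integrableOn_Ioc_of_le zero_le_one).1
      ((hf.pow 2).intervalIntegrable 0 1)))

theorem norm_toL2_le {f : ℝ → ℝ} {C : ℝ} (hC : 0 ≤ C) (hf : ∀ x ∈ Icc (0 : ℝ) 1, |f x| ≤ C) :
    ‖toL2 f‖ ≤ C := by
  by_cases hm : MemLp f 2 circleMeasure
  · refine abs_le_of_sq_le_sq' ?_ hC |>.2
    rw [norm_toL2_sq hm, normSq]
    calc ∫ x in Ioc (0 : ℝ) 1, f x ^ 2 ≤ ∫ x in Ioc (0 : ℝ) 1, C ^ 2 := by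
          refine setIntegral_mono_on hm.integrable_sq (by simp) measurableSet_Ioc fun x hx => ?_
          rw [← sq_abs]
          exact pow_le_pow_left₀ (abs_nonneg _) (hf x (Ioc_subset_Icc_self hx)) 2
      _ = C ^ 2 := by simp
  · rw [toL2, dif_neg hm, norm_zero]
    exact hC

theorem memLp_mul_of_continuous {v f : ℝ → ℝ} (hv : Continuous v)
    (hf : MemLp f 2 circleMeasure) : MemLp (fun x => v x * f x) 2 circleMeasure := by
  obtain ⟨C, hC⟩ := isCompact_Icc.exists_bound_of_continuousOn
    (hv.continuousOn (s := Icc (0 : ℝ) 1))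
  refine (hf.const_mul C).mono (hv.aestronglyMeasurable.mul hf.1) ?_
  filter_upwards [ae_restrict_mem measurableSet_Ioc] with x hx
  rw [norm_mul, norm_mul]
  exact mul_le_mul_of_nonneg_right ((hC x (Ioc_subset_Icc_self hx)).trans (le_abs_self _))
    (norm_nonneg _)

theorem norm_toL2_mul_le {v f : ℝ → ℝ} {C : ℝ} (hv : Continuous v)
    (hf : MemLp f 2 circleMeasure) (hC : ∀ x ∈ Icc (0 : ℝ) 1, |v x| ≤ C) :
    ‖toL2 fun x => v x * f x‖ ≤ C * ‖toL2 f‖ := by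
  have hC0 : 0 ≤ C := (abs_nonneg _).trans (hC 0 (by simp))
  rw [toL2_eq (memLp_mul_of_continuous hv hf), toL2_eq hf, Lp.norm_toLp, Lp.norm_toLp]
  have := eLpNorm_le_mul_eLpNorm_of_ae_le_mul (μ := circleMeasure) (f := fun x => v x * f x)
    (g := f) (c := C) (by
      filter_upwards [ae_restrict_mem measurableSet_Ioc] with x hx
      rw [norm_mul]
      exact mul_le_mul_of_nonneg_right (hC x (Ioc_subset_Icc_self hx)) (norm_nonneg _)) 2
  calc _ ≤ (ENNReal.ofReal C * eLpNorm f 2 circleMeasure).toReal :=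
        ENNReal.toReal_mono (ENNReal.mul_ne_top ENNReal.ofReal_ne_top hf.2.ne) this
    _ = _ := by rw [ENNReal.toReal_mul, ENNReal.toReal_ofReal hC0]

/-! ### Test functions -/

/-- Smooth functions on the circle. -/
def IsTest (θ : ℝ → ℝ) : Prop := ContDiff ℝ ∞ θ ∧ Function.Periodic θ 1

namespace IsTest

variable {θ : ℝ → ℝ}

theorem continuous (hθ : IsTest θ) : Continuous θ := hθ.1.continuous

theorem differentiable (hθ : IsTest θ) : Differentiable ℝ θ := hθ.1.differentiable (by simp)

theorem continuous_deriv (hθ : IsTest θ) : Continuous (deriv θ) :=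
  hθ.1.continuous_deriv (by simp)

theorem periodic_deriv (hθ : IsTest θ) : Function.Periodic (deriv θ) 1 := fun x => by
  rw [← deriv_comp_add_const]
  congr 1
  exact funext hθ.2

theorem memLp (hθ : IsTest θ) : MemLp θ 2 circleMeasure := memLp_of_continuous hθ.continuous

theorem memLp_deriv (hθ : IsTest θ) : MemLp (deriv θ) 2 circleMeasure :=
  memLp_of_continuous hθ.continuous_deriv

theorem add {η : ℝ → ℝ} (hθ : IsTest θ) (hη : IsTest η) : IsTest fun x => θ x + η x :=
  ⟨hθ.1.add hη.1, hθ.2.add hη.2⟩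

theorem const_mul (c : ℝ) (hθ : IsTest θ) : IsTest fun x => c * θ x :=
  ⟨contDiff_const.mul hθ.1, fun x => by simp only [hθ.2 x]⟩

end IsTest

theorem _root_.Function.Periodic.exists_abs_le {g : ℝ → ℝ} (hg : Function.Periodic g 1)
    (hc : Continuous g) : ∃ C, 0 ≤ C ∧ ∀ x, |g x| ≤ C := by
  obtain ⟨C, hC⟩ := isCompact_Icc.exists_bound_of_continuousOn
    (hc.continuousOn (s := Icc (0 : ℝ) 1))
  refine ⟨C, (norm_nonneg _).trans (hC 0 (by simp)), fun x => ?_⟩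
  obtain ⟨y, hy, hxy⟩ := hg.exists_mem_Ico₀ one_pos x
  rw [hxy]
  exact hC y (Ico_subset_Icc_self hy)

theorem isTest_cos (k : ℤ) : IsTest fun x => Real.cos (2 * Real.pi * k * x) := by
  refine ⟨by fun_prop, fun x => ?_⟩
  simp only
  rw [show 2 * Real.pi * k * (x + 1) = 2 * Real.pi * k * x + k * (2 * Real.pi) by ring,
    Real.cos_add_int_mul_two_pi]

theorem isTest_sin (k : ℤ) : IsTest fun x => Real.sin (2 * Real.pi * k * x) := by
  refine ⟨by fun_prop, fun x => ?_⟩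
  simp only
  rw [show 2 * Real.pi * k * (x + 1) = 2 * Real.pi * k * x + k * (2 * Real.pi) by ring,
    Real.sin_add_int_mul_two_pi]

theorem deriv_cos_mul (m : ℝ) :
    deriv (fun x => Real.cos (m * x)) = fun x => -m * Real.sin (m * x) := by
  funext x
  refine HasDerivAt.deriv (((hasDerivAt_id x).const_mul m).cos.congr_deriv ?_)
  simp [mul_comm]

theorem deriv_sin_mul (m : ℝ) :
    deriv (fun x => Real.sin (m * x)) = fun x => m * Real.cos (m * x) := by
  funext x
  refine HasDerivAt.deriv (((hasDerivAt_id x).const_mul m).sin.congr_deriv ?_)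
  simp [mul_comm]

/-- Completeness of the trigonometric system. -/
theorem eq_zero_of_inner_cos_sin {e : L2Circle}
    (hc : ∀ k : ℤ, inner ℝ e (toL2 fun x => Real.cos (2 * Real.pi * k * x)) = 0)
    (hs : ∀ k : ℤ, inner ℝ e (toL2 fun x => Real.sin (2 * Real.pi * k * x)) = 0) : e = 0 := by
  have he : MemLp e 2 circleMeasure := Lp.memLp e
  have hint : ∀ g : ℝ → ℝ, Continuous g → IntervalIntegrable (fun x => e x * g x) volume 0 1 :=
    fun g hg => IntervalIntegrable.mul_continuousOn
      ((intervalIntegrable_iff_integrableOn_Ioc_of_le zero_le_one).2 (he.integrable one_le_two))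
      hg.continuousOn
  have hcoeff : ∀ k : ℤ, fourierCoeffOn zero_lt_one (fun x => (e x : ℂ)) k = 0 := fun k => by
    have h1 := hc k
    have h2 := hs k
    rw [inner_toL2_right _ (isTest_cos k).memLp] at h1
    rw [inner_toL2_right _ (isTest_sin k).memLp] at h2
    rw [fourierCoeffOn_eq_integral]
    have h3 : ∀ x : ℝ, fourier (-k) (x : AddCircle ((1 : ℝ) - 0)) • (e x : ℂ) =
        ((e x * Real.cos (2 * Real.pi * k * x) : ℝ) : ℂ) -
          Complex.I * ((e x * Real.sin (2 * Real.pi * k * x) : ℝ) : ℂ) := fun x => by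
      rw [fourier_coe_apply, show 2 * (Real.pi : ℂ) * Complex.I * ((-k : ℤ) : ℂ) * x /
        ((1 - 0 : ℝ) : ℂ) = -((2 * Real.pi * k * x : ℝ) : ℂ) * Complex.I by push_cast; ring,
        ← Complex.ofReal_neg, Complex.exp_mul_I, ← Complex.ofReal_cos, ← Complex.ofReal_sin,
        Real.cos_neg, Real.sin_neg, smul_eq_mul]
      push_cast
      ring
    simp only [h3]
    rw [intervalIntegral.integral_sub, intervalIntegral.integral_const_mul,
      intervalIntegral.integral_ofReal, intervalIntegral.integral_ofReal, h1, h2]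
    · simp
    · exact ⟨(hint _ (isTest_cos k).continuous).1.ofReal, (hint _ (isTest_cos k).continuous).2.ofReal⟩
    · exact IntervalIntegrable.const_mul ⟨(hint _ (isTest_sin k).continuous).1.ofReal,
        (hint _ (isTest_sin k).continuous).2.ofReal⟩ _
  have hL2 : MemLp (fun x => (e x : ℂ)) 2 (volume.restrict (Ioc (0 : ℝ) 1)) := he.ofReal
  -- Parseval: every Fourier coefficient vanishes, so the norm does.
  have h1 := hasSum_sq_fourierCoeffOn zero_lt_one hL2
  simp only [hcoeff, norm_zero, ne_eq, OfNat.ofNat_ne_zero, not_false_eq_true, zero_pow,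
    sub_zero, inv_one, one_smul, Complex.norm_real] at h1
  have h2 : ∫ x in (0 : ℝ)..1, ‖e x‖ ^ 2 = 0 := h1.unique hasSum_zero
  have h3 : ‖e‖ ^ 2 = 0 := by
    rw [← real_inner_self_eq_norm_sq, L2.inner_def, ← h2,
      intervalIntegral.integral_of_le zero_le_one]
    refine integral_congr_ae (ae_of_all _ fun x => ?_)
    simp [sq]
  simpa using h3

/-- The classes of the smooth functions in `L²(𝕊)`. -/
noncomputable def testL2 : Submodule ℝ L2Circle where
  carrier := {e | ∃ θ, IsTest θ ∧ toL2 θ = e}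
  zero_mem' := ⟨fun _ => 0, ⟨contDiff_const, fun _ => rfl⟩,
    (toL2_eq (memLp_of_continuous continuous_const)).trans (MemLp.toLp_zero _)⟩
  add_mem' := by
    rintro _ _ ⟨θ, hθ, rfl⟩ ⟨η, hη, rfl⟩
    exact ⟨_, hθ.add hη, toL2_add hθ.memLp hη.memLp⟩
  smul_mem' := by
    rintro c _ ⟨θ, hθ, rfl⟩
    exact ⟨_, hθ.const_mul c, toL2_smul c hθ.memLp⟩

theorem dense_testL2 : Dense (testL2 : Set L2Circle) := by
  rw [Submodule.dense_iff_topologicalClosure_eq_top, Submodule.topologicalClosure_eq_top_iff,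
    Submodule.eq_bot_iff]
  intro e he
  rw [Submodule.mem_orthogonal'] at he
  exact eq_zero_of_inner_cos_sin (fun k => he _ ⟨_, isTest_cos k, rfl⟩)
    fun k => he _ ⟨_, isTest_sin k, rfl⟩

/-- The bound extends to all of L² by density and is then applied to `e` itself. -/
theorem norm_le_of_inner_testL2 {e : L2Circle} {C : ℝ} (hC : 0 ≤ C)
    (he : ∀ θ, IsTest θ → |inner ℝ e (toL2 θ)| ≤ C * ‖toL2 θ‖) : ‖e‖ ≤ C := by
  have hcl : IsClosed {f : L2Circle | |inner ℝ e f| ≤ C * ‖f‖} :=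
    isClosed_le (by fun_prop) (by fun_prop)
  have hall : ∀ f : L2Circle, |inner ℝ e f| ≤ C * ‖f‖ := fun f =>
    hcl.closure_subset_iff.2 (by rintro _ ⟨θ, hθ, rfl⟩; exact he θ hθ) (dense_testL2 f)
  have := hall e
  rw [real_inner_self_eq_norm_sq, abs_of_nonneg (sq_nonneg _)] at this
  by_contra! hlt
  nlinarith [norm_nonneg e]

/-! ### The space `H¹(𝕊)` -/

/-- Each test function imposes a closed condition. The resulting completeness lets density be read
off from the orthogonal complement. -/
theorem isClosed_H1Circle :
    IsClosed (H1Circle : Set (WithLp 2 (L2Circle × L2Circle))) := by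
  have : (H1Circle : Set (WithLp 2 (L2Circle × L2Circle))) =
      ⋂ (θ : ℝ → ℝ) (_ : ContDiff ℝ ∞ θ) (_ : Function.Periodic θ 1),
        {p | inner ℝ p.fst (toL2 (deriv θ)) + inner ℝ p.snd (toL2 θ) = 0} := by
    ext p
    simp only [mem_iInter]
    rfl
  rw [this]
  refine isClosed_iInter fun θ => isClosed_iInter fun _ => isClosed_iInter fun _ => ?_
  have h1 : Continuous fun p : WithLp 2 (L2Circle × L2Circle) => p.fst :=
    (WithLp.fstL 2 ℝ L2Circle L2Circle).continuous
  have h2 : Continuous fun p : WithLp 2 (L2Circle × L2Circle) => p.snd :=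
    (WithLp.sndL 2 ℝ L2Circle L2Circle).continuous
  exact isClosed_eq (by fun_prop) continuous_const

instance : CompleteSpace H1Circle := isClosed_H1Circle.completeSpace_coe

theorem test_mem_H1Circle {θ : ℝ → ℝ} (hθ : IsTest θ) :
    WithLp.toLp 2 (toL2 θ, toL2 (deriv θ)) ∈ H1Circle := by
  intro η hη hη'
  have hη : IsTest η := ⟨hη, hη'⟩
  change inner ℝ (toL2 θ) (toL2 (deriv η)) + inner ℝ (toL2 (deriv θ)) (toL2 η) = 0
  rw [inner_toL2 hθ.memLp hη.memLp_deriv, inner_toL2 hθ.memLp_deriv hη.memLp,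
    intervalIntegral.integral_mul_deriv_eq_deriv_mul (u := θ) (v := η) (u' := deriv θ)
      (fun x _ => (hθ.differentiable x).hasDerivAt) (fun x _ => (hη.differentiable x).hasDerivAt)
      (hθ.continuous_deriv.intervalIntegrable _ _) (hη.continuous_deriv.intervalIntegrable _ _)]
  have h1 := hθ.2 0
  have h2 := hη.2 0
  rw [zero_add] at h1 h2
  rw [h1, h2]
  ring

/-- The smooth functions in `H¹(𝕊)`. -/
noncomputable def testH1 : Submodule ℝ H1Circle where
  carrier := {p | ∃ θ, IsTest θ ∧ WithLp.toLp 2 (toL2 θ, toL2 (deriv θ)) = p.1}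
  zero_mem' := by
    have h0 : toL2 (fun _ => 0) = 0 :=
      (toL2_eq (memLp_of_continuous continuous_const)).trans (MemLp.toLp_zero _)
    refine ⟨fun _ => 0, ⟨contDiff_const, fun _ => rfl⟩, ?_⟩
    rw [deriv_const', h0]
    rfl
  add_mem' := by
    rintro p q ⟨θ, hθ, hp⟩ ⟨η, hη, hq⟩
    refine ⟨_, hθ.add hη, ?_⟩
    have : deriv (fun x => θ x + η x) = fun x => deriv θ x + deriv η x :=
      funext fun x => deriv_fun_add (hθ.differentiable x) (hη.differentiable x)
    rw [this, toL2_add hθ.memLp hη.memLp, toL2_add hθ.memLp_deriv hη.memLp_deriv,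
      Submodule.coe_add, ← hp, ← hq]
    rfl
  smul_mem' := by
    rintro c p ⟨θ, hθ, hp⟩
    refine ⟨_, hθ.const_mul c, ?_⟩
    have : deriv (fun x => c * θ x) = fun x => c * deriv θ x :=
      funext fun x => deriv_const_mul c (hθ.differentiable x)
    rw [this, toL2_smul c hθ.memLp, toL2_smul c hθ.memLp_deriv, Submodule.coe_smul, ← hp]
    rfl

/-- At each frequency m, orthogonality to the test functions gives two relations between the Fourier
coefficients of the two components, and the weak-derivative condition gives two more. Eliminating
leaves the factor 1 + m², so all coefficients vanish. -/
theorem dense_testH1 : Dense (testH1 : Set H1Circle) := by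
  rw [Submodule.dense_iff_topologicalClosure_eq_top, Submodule.topologicalClosure_eq_top_iff,
    Submodule.eq_bot_iff]
  intro p hp
  rw [Submodule.mem_orthogonal'] at hp
  have hp' : ∀ θ, IsTest θ → inner ℝ p.1.fst (toL2 θ) + inner ℝ p.1.snd (toL2 (deriv θ)) = 0 :=
    fun θ hθ => by
      have := hp ⟨_, test_mem_H1Circle hθ⟩ ⟨θ, hθ, rfl⟩
      rwa [Submodule.coe_inner, WithLp.prod_inner_apply] at this
  have hk : ∀ k : ℤ, (inner ℝ p.1.fst (toL2 fun x => Real.cos (2 * Real.pi * k * x)) = 0 ∧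
      inner ℝ p.1.snd (toL2 fun x => Real.sin (2 * Real.pi * k * x)) = 0) ∧
      inner ℝ p.1.fst (toL2 fun x => Real.sin (2 * Real.pi * k * x)) = 0 ∧
      inner ℝ p.1.snd (toL2 fun x => Real.cos (2 * Real.pi * k * x)) = 0 := fun k => by
    have h1 := hp' _ (isTest_cos k)
    have h2 := hp' _ (isTest_sin k)
    have h3 := p.2 _ (isTest_cos k).1 (isTest_cos k).2
    have h4 := p.2 _ (isTest_sin k).1 (isTest_sin k).2
    rw [deriv_cos_mul, toL2_smul _ (isTest_sin k).memLp, real_inner_smul_right] at h1 h3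
    rw [deriv_sin_mul, toL2_smul _ (isTest_cos k).memLp, real_inner_smul_right] at h2 h4
    generalize inner ℝ p.1.fst (toL2 fun x => Real.cos (2 * Real.pi * k * x)) = A at *
    generalize inner ℝ p.1.snd (toL2 fun x => Real.cos (2 * Real.pi * k * x)) = B at *
    generalize inner ℝ p.1.fst (toL2 fun x => Real.sin (2 * Real.pi * k * x)) = C at *
    generalize inner ℝ p.1.snd (toL2 fun x => Real.sin (2 * Real.pi * k * x)) = D at *
    generalize 2 * Real.pi * (k : ℝ) = m at *
    have hm : 1 + m ^ 2 ≠ 0 := by positivity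
    have hA : A = 0 := (mul_eq_zero.1 (by linear_combination h1 + m * h4 :
      (1 + m ^ 2) * A = 0)).resolve_left hm
    have hC : C = 0 := (mul_eq_zero.1 (by linear_combination h2 - m * h3 :
      (1 + m ^ 2) * C = 0)).resolve_left hm
    subst hA hC
    exact ⟨⟨rfl, by linarith⟩, rfl, by linarith⟩
  have h1 : p.1.fst = 0 := eq_zero_of_inner_cos_sin (fun k => (hk k).1.1) fun k => (hk k).2.1
  have h2 : p.1.snd = 0 := eq_zero_of_inner_cos_sin (fun k => (hk k).2.2) fun k => (hk k).1.2
  refine Subtype.ext ?_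
  refine (WithLp.ofLp_injective 2) (Prod.ext h1 h2)

theorem norm_le_of_testH1 {l : HNegOne} {C : ℝ} (hC : 0 ≤ C)
    (hl : ∀ p ∈ testH1, |l p| ≤ C * ‖p‖) : ‖l‖ ≤ C := by
  have hcl : IsClosed {p : H1Circle | |l p| ≤ C * ‖p‖} :=
    isClosed_le (by fun_prop) (by fun_prop)
  exact l.opNorm_le_bound hC fun p => hcl.closure_subset_iff.2 hl (dense_testH1 p)

/-! ### Vector-valued curves tested against functionals -/

/-- The increment is the integral of g' − c, which does not see the countable set. The bound `M`
serves only to make g' integrable. -/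
theorem abs_sub_sub_le_of_hasDerivAt_off_countable {g g' : ℝ → ℝ}
    (hg : ∀ t, HasDerivAt g (g' t) t) {M : ℝ} (hM : ∀ t, |g' t| ≤ M) {S : Set ℝ}
    (hS : S.Countable) {c ε s t : ℝ} (hc : ∀ τ ∈ uIoc s t, τ ∉ S → |g' τ - c| ≤ ε) :
    |g t - g s - c * (t - s)| ≤ ε * |t - s| := by
  have hg' : g' = deriv g := funext fun t => (hg t).deriv.symm
  have hint : IntervalIntegrable g' volume s t := by
    refine (intervalIntegrable_const (c := M)).mono_fun' ?_ (ae_of_all _ hM)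
    rw [hg']
    exact (measurable_deriv g).aestronglyMeasurable
  have h1 := intervalIntegral.integral_eq_sub_of_hasDerivAt (fun τ _ => hg τ) hint
  have h2 : ∫ τ in s..t, (g' τ - c) = g t - g s - c * (t - s) := by
    rw [intervalIntegral.integral_sub hint intervalIntegrable_const, h1,
      intervalIntegral.integral_const, smul_eq_mul, mul_comm c]
  rw [← h2, ← Real.norm_eq_abs]
  refine intervalIntegral.norm_integral_le_of_norm_le_const_ae ?_
  filter_upwards [hS.ae_notMem volume] with τ hτ hmem
  exact hc τ hmem hτ

section Tested

variable {E ι : Type*} [NormedAddCommGroup E] [NormedSpace ℝ E] {l : ι → E →L[ℝ] ℝ} {N : ι → ℝ}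
  {U F : ℝ → E} {S : Set ℝ}

/-- The functionals `l i` determine the norm, so a scalar mean value estimate, uniform in i after
division by `N i`, is a vector one. The scalar derivatives exist at all times but agree with `F`
only off `S`. -/
theorem norm_sub_sub_le_of_tested
    (hnorm : ∀ e C, 0 ≤ C → (∀ i, |l i e| ≤ C * N i) → ‖e‖ ≤ C)
    (hN : ∀ i e, |l i e| ≤ ‖e‖ * N i) (hN0 : ∀ i, 0 ≤ N i) (hS : S.Countable)
    (hD : ∀ i, ∃ D : ℝ → ℝ, (∀ t, HasDerivAt (fun s => l i (U s)) (D t) t) ∧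
      (∃ M, ∀ t, |D t| ≤ M) ∧ ∀ t, t ∉ S → D t = l i (F t))
    {e₀ : E} {ε s t : ℝ} (hε : 0 ≤ ε) (hF : ∀ τ ∈ uIoc s t, τ ∉ S → ‖F τ - e₀‖ ≤ ε) :
    ‖U t - U s - (t - s) • e₀‖ ≤ ε * |t - s| := by
  refine hnorm _ _ (by positivity) fun i => ?_
  obtain ⟨D, hD1, ⟨M, hM⟩, hD2⟩ := hD i
  have := abs_sub_sub_le_of_hasDerivAt_off_countable hD1 hM hS (c := l i e₀) (ε := ε * N i)
    (s := s) (t := t) fun τ hτ hτS => by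
      rw [hD2 τ hτS, ← map_sub]
      exact (hN i _).trans (mul_le_mul_of_nonneg_right (hF τ hτ hτS) (hN0 i))
  rw [map_sub, map_sub, map_smul, smul_eq_mul, mul_comm (t - s)]
  linarith

theorem norm_sub_le_of_tested
    (hnorm : ∀ e C, 0 ≤ C → (∀ i, |l i e| ≤ C * N i) → ‖e‖ ≤ C)
    (hN : ∀ i e, |l i e| ≤ ‖e‖ * N i) (hN0 : ∀ i, 0 ≤ N i) (hS : S.Countable)
    (hD : ∀ i, ∃ D : ℝ → ℝ, (∀ t, HasDerivAt (fun s => l i (U s)) (D t) t) ∧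
      (∃ M, ∀ t, |D t| ≤ M) ∧ ∀ t, t ∉ S → D t = l i (F t))
    {C : ℝ} (hC : 0 ≤ C) (hF : ∀ t, ‖F t‖ ≤ C) (s t : ℝ) : ‖U t - U s‖ ≤ C * |t - s| := by
  have := norm_sub_sub_le_of_tested hnorm hN hN0 hS hD (e₀ := 0) (s := s) (t := t) hC
    fun τ _ _ => by simpa using hF τ
  simpa using this

/-- Take `e₀ = F t`: continuity of `F` at t makes the error o(|s − t|) in norm. -/
theorem hasDerivAt_of_tested
    (hnorm : ∀ e C, 0 ≤ C → (∀ i, |l i e| ≤ C * N i) → ‖e‖ ≤ C)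
    (hN : ∀ i e, |l i e| ≤ ‖e‖ * N i) (hN0 : ∀ i, 0 ≤ N i) (hS : S.Countable)
    (hD : ∀ i, ∃ D : ℝ → ℝ, (∀ t, HasDerivAt (fun s => l i (U s)) (D t) t) ∧
      (∃ M, ∀ t, |D t| ≤ M) ∧ ∀ t, t ∉ S → D t = l i (F t))
    {t : ℝ} (hF : ContinuousAt F t) : HasDerivAt U (F t) t := by
  rw [hasDerivAt_iff_isLittleO, Asymptotics.isLittleO_iff]
  intro ε hε
  obtain ⟨δ, hδ, hball⟩ := Metric.continuousAt_iff.1 hF ε hε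
  filter_upwards [Metric.ball_mem_nhds t hδ] with s hs
  refine norm_sub_sub_le_of_tested hnorm hN hN0 hS hD hε.le fun τ hτ _ => ?_
  rw [← dist_eq_norm]
  refine (hball ?_).le
  rw [Metric.mem_ball, Real.dist_eq] at hs
  rw [Real.dist_eq]
  have h1 := abs_sub_left_of_mem_uIcc (uIoc_subset_uIcc hτ)
  exact h1.trans_lt hs

end Tested

/-! ### Weak and strong convergence in `L²(𝕊)` -/

theorem tendsto_inner_of_bounded {X : ℝ → L2Circle} {M t : ℝ} (hM : ∀ s, ‖X s‖ ≤ M)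
    (hX : ∀ θ, IsTest θ → Tendsto (fun s => inner ℝ (X s) (toL2 θ)) (𝓝 t)
      (𝓝 (inner ℝ (X t) (toL2 θ)))) (e : L2Circle) :
    Tendsto (fun s => inner ℝ (X s) e) (𝓝 t) (𝓝 (inner ℝ (X t) e)) := by
  have hM0 : 0 ≤ M := (norm_nonneg _).trans (hM 0)
  rw [Metric.tendsto_nhds]
  intro ε hε
  -- Three-term splitting: with this accuracy, replacing `e` by the test function costs at most ε/3
  -- at any time. The `+ 1` keeps the denominator positive.
  obtain ⟨_, ⟨θ, hθ, rfl⟩, hd⟩ := dense_testL2.exists_dist_lt e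
    (show 0 < ε / (3 * (M + 1)) by positivity)
  filter_upwards [Metric.tendsto_nhds.1 (hX θ hθ) (ε / 3) (by positivity)] with s hs
  have hlt : ∀ τ, |inner ℝ (X τ) (e - toL2 θ)| ≤ ε / 3 := fun τ => by
    refine (abs_real_inner_le_norm _ _).trans ?_
    rw [dist_eq_norm, lt_div_iff₀ (by positivity)] at hd
    nlinarith [hM τ, norm_nonneg (e - toL2 θ), norm_nonneg (X τ)]
  have h1 := abs_le.1 (hlt s)
  have h2 := abs_le.1 (hlt t)
  rw [Real.dist_eq, abs_lt] at hs ⊢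
  rw [inner_sub_right] at h1 h2
  constructor <;> linarith [h1.1, h1.2, h2.1, h2.2, hs.1, hs.2]

/-- Weak continuity together with maximality of the norm gives strong continuity. -/
theorem tendsto_norm_sq_of_weak {X Y : ℝ → L2Circle} {K t : ℝ}
    (hK : ∀ s, ‖X s‖ ^ 2 + ‖Y s‖ ^ 2 ≤ K) (ht : ‖X t‖ ^ 2 + ‖Y t‖ ^ 2 = K)
    (hX : ∀ θ, IsTest θ → Tendsto (fun s => inner ℝ (X s) (toL2 θ)) (𝓝 t)
      (𝓝 (inner ℝ (X t) (toL2 θ))))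
    (hY : ∀ θ, IsTest θ → Tendsto (fun s => inner ℝ (Y s) (toL2 θ)) (𝓝 t)
      (𝓝 (inner ℝ (Y t) (toL2 θ)))) : ContinuousAt X t ∧ ContinuousAt Y t := by
  have hbX : ∀ s, ‖X s‖ ≤ √K := fun s => Real.le_sqrt_of_sq_le (by nlinarith [hK s, sq_nonneg ‖Y s‖])
  have hbY : ∀ s, ‖Y s‖ ≤ √K := fun s => Real.le_sqrt_of_sq_le (by nlinarith [hK s, sq_nonneg ‖X s‖])
  have h1 := tendsto_inner_of_bounded hbX hX (X t)
  have h2 := tendsto_inner_of_bounded hbY hY (Y t)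
  have h3 : Tendsto (fun s => 2 * K - 2 * (inner ℝ (X s) (X t) + inner ℝ (Y s) (Y t)))
      (𝓝 t) (𝓝 0) := by
    have := ((h1.add h2).const_mul 2).const_sub (2 * K)
    rw [real_inner_self_eq_norm_sq, real_inner_self_eq_norm_sq, ht, sub_self] at this
    exact this
  -- Expand the squares: the norms at time s contribute at most K and those at time t exactly K.
  have h4 : ∀ s, ‖X s - X t‖ ^ 2 + ‖Y s - Y t‖ ^ 2 ≤
      2 * K - 2 * (inner ℝ (X s) (X t) + inner ℝ (Y s) (Y t)) := fun s => by
    rw [norm_sub_sq_real, norm_sub_sq_real]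
    linarith [hK s]
  have key : ∀ Z : ℝ → L2Circle, (∀ s, ‖Z s - Z t‖ ^ 2 ≤ ‖X s - X t‖ ^ 2 + ‖Y s - Y t‖ ^ 2) →
      ContinuousAt Z t := fun Z hZ => by
    have h5 := squeeze_zero (fun s => sq_nonneg ‖Z s - Z t‖) (fun s => (hZ s).trans (h4 s)) h3
    have h6 := h5.sqrt
    simp only [Real.sqrt_sq (norm_nonneg _), Real.sqrt_zero] at h6
    exact tendsto_iff_norm_sub_tendsto_zero.2 h6
  exact ⟨key X fun s => by linarith [sq_nonneg ‖Y s - Y t‖],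
    key Y fun s => by linarith [sq_nonneg ‖X s - X t‖]⟩

/-! ### Bounds and countability of the exceptional times -/

theorem abs_sin_mul_cos_le (t : ℝ) : |Real.sin t * Real.cos t| ≤ 1 := by
  rw [abs_mul]
  exact mul_le_one₀ (Real.abs_sin_le_one t) (abs_nonneg _) (Real.abs_cos_le_one t)

theorem abs_cos_sq_sub_sin_sq_le (t : ℝ) : |Real.cos t ^ 2 - Real.sin t ^ 2| ≤ 1 := by
  have := Real.sin_sq_add_cos_sq t
  rw [abs_le]
  constructor <;> nlinarith [sq_nonneg (Real.sin t), sq_nonneg (Real.cos t)]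

theorem abs_linear_combination_le {A B D : ℝ} (hA : |A| ≤ 4) (hB : |B| ≤ 4) (hD : |D| ≤ 4)
    (x y z : ℝ) : |A * x + B * y + D * z| ≤ 4 * (|x| + |y| + |z|) := by
  refine (abs_add_three _ _ _).trans ?_
  rw [abs_mul, abs_mul, abs_mul]
  linarith [mul_le_mul_of_nonneg_right hA (abs_nonneg x),
    mul_le_mul_of_nonneg_right hB (abs_nonneg y), mul_le_mul_of_nonneg_right hD (abs_nonneg z)]

theorem abs_geoPhiT_le (t x : ℝ) :
    |geoPhiT u₀ ρ₀ t x| ≤ 4 * (|x| + |u₀ x| + |cumEnergy u₀ ρ₀ x|) := by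
  have h1 := abs_le.1 (abs_sin_mul_cos_le t)
  have h2 := abs_le.1 (abs_cos_sq_sub_sin_sq_le t)
  refine abs_linear_combination_le ?_ ?_ ?_ _ _ _ <;> rw [abs_le] <;>
    constructor <;> linarith [h1.1, h1.2, h2.1, h2.2]

theorem abs_geoPhiTX_le (t x : ℝ) : |geoPhiTX u₀ ρ₀ t x| ≤
    4 * (1 + |deriv u₀ x| + |deriv u₀ x ^ 2 + ρ₀ x ^ 2|) := by
  have h1 := abs_le.1 (abs_sin_mul_cos_le t)
  have h2 := abs_le.1 (abs_cos_sq_sub_sin_sq_le t)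
  have := abs_linear_combination_le (A := -2 * Real.sin t * Real.cos t)
    (B := Real.cos t ^ 2 - Real.sin t ^ 2) (D := Real.sin t * Real.cos t / 2) (by
      rw [abs_le]; constructor <;> linarith [h1.1, h1.2])
    (by rw [abs_le]; constructor <;> linarith [h2.1, h2.2]) (by
      rw [abs_le]; constructor <;> linarith [h1.1, h1.2]) 1 (deriv u₀ x)
      (deriv u₀ x ^ 2 + ρ₀ x ^ 2)
  rwa [mul_one, abs_one] at this

theorem abs_geoPhiTT_le (t x : ℝ) :
    |geoPhiTT u₀ ρ₀ t x| ≤ 4 * (|x| + |u₀ x| + |cumEnergy u₀ ρ₀ x|) := by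
  have h1 := abs_le.1 (abs_sin_mul_cos_le t)
  have h2 := abs_le.1 (abs_cos_sq_sub_sin_sq_le t)
  have := abs_linear_combination_le (A := -2 * (Real.cos t ^ 2 - Real.sin t ^ 2))
    (B := -4 * (Real.sin t * Real.cos t)) (D := (Real.cos t ^ 2 - Real.sin t ^ 2) / 2) (by
      rw [abs_le]; constructor <;> linarith [h2.1, h2.2]) (by
      rw [abs_le]; constructor <;> linarith [h1.1, h1.2]) (by
      rw [abs_le]; constructor <;> linarith [h2.1, h2.2]) x (u₀ x) (cumEnergy u₀ ρ₀ x)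
  refine le_trans (le_of_eq ?_) this
  unfold geoPhiTT
  congr 1
  ring

/-- The times at which `φₓ` vanishes on a set of positive measure. -/
def exceptionalTimes (u₀ ρ₀ : ℝ → ℝ) : Set ℝ :=
  {t | ¬ ∀ᵐ x ∂circleMeasure, geoPhiX u₀ ρ₀ t x ≠ 0}

/-- At an exceptional time the level set of u₀' at height −2 cot t has positive measure. Level sets
are disjoint in a space of finite measure, so only countably many heights occur, and each height
determines t modulo π. -/
theorem countable_exceptionalTimes : (exceptionalTimes u₀ ρ₀).Countable := by
  have hA : {c : ℝ | 0 < circleMeasure {x | deriv u₀ x = c}}.Countable :=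
    Measure.countable_meas_level_set_pos (measurable_deriv u₀)
  have hsub : exceptionalTimes u₀ ρ₀ ⊆ ⋃ c ∈ {c : ℝ | 0 < circleMeasure {x | deriv u₀ x = c}},
      {t | Real.sin t ≠ 0 ∧ c = -2 * Real.cot t} := by
    intro t ht
    have hs : Real.sin t ≠ 0 := fun hs => ht (ae_of_all _ fun x hx =>
      (geoPhiX_eq_zero_iff.1 hx).1 hs)
    refine mem_biUnion (x := -2 * Real.cot t) ?_ ⟨hs, rfl⟩
    change 0 < circleMeasure {x | deriv u₀ x = -2 * Real.cot t}
    refine pos_iff_ne_zero.2 fun h0 => ht ?_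
    rw [ae_iff]
    refine measure_mono_null (fun x hx => ?_) h0
    exact (geoPhiX_eq_zero_iff.1 (not_not.1 hx)).2.1
  refine (hA.biUnion fun c _ => ?_).mono hsub
  rcases {t | Real.sin t ≠ 0 ∧ c = -2 * Real.cot t}.eq_empty_or_nonempty with he | ⟨s, hs, hcs⟩
  · rw [he]; exact countable_empty
  refine (countable_range fun n : ℤ => s + n * Real.pi).mono ?_
  rintro t ⟨ht, hct⟩
  have h1 : Real.sin (t - s) = 0 := by
    have h2 : Real.cot s = Real.cot t := by linarith
    rw [Real.cot_eq_cos_div_sin, Real.cot_eq_cos_div_sin, div_eq_div_iff hs ht] at h2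
    rw [Real.sin_sub]
    linarith
  obtain ⟨n, hn⟩ := Real.sin_eq_zero_iff.1 h1
  exact ⟨n, by simp only [hn]; ring⟩

namespace IsUnitData

variable (h : IsUnitData u₀ ρ₀)
include h

theorem exists_abs_le : ∃ K, 0 ≤ K ∧ ∀ t, ∀ x ∈ Icc (0 : ℝ) 1,
    |geoPhiT u₀ ρ₀ t x| ≤ K ∧ |geoPhiTT u₀ ρ₀ t x| ≤ K := by
  obtain ⟨C, hC0, hC⟩ := h.periodic_u.exists_abs_le h.continuous_u
  have hK : ∀ x ∈ Icc (0 : ℝ) 1, 4 * (|x| + |u₀ x| + |cumEnergy u₀ ρ₀ x|) ≤ 4 * (1 + C + 4) :=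
    fun x hx => by
      have h1 := h.cumEnergy_mem hx
      rw [abs_of_nonneg hx.1, abs_of_nonneg h1.1]
      linarith [hx.2, h1.2, hC x]
  exact ⟨4 * (1 + C + 4), by positivity, fun t x hx =>
    ⟨(abs_geoPhiT_le t x).trans (hK x hx), (abs_geoPhiTT_le t x).trans (hK x hx)⟩⟩

end IsUnitData

/-! ### The flow as a family in time -/

/-- `(U t, R t)` is the state of the flow at time `t`, for every `t`. -/
def IsFlow (u₀ ρ₀ : ℝ → ℝ) (U R : ℝ → ℝ → ℝ) : Prop := ∀ t, IsFlowAt u₀ ρ₀ t (U t) (R t)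

namespace IsFlow

variable {U R : ℝ → ℝ → ℝ} (hf : IsFlow u₀ ρ₀ U R) (h : IsUnitData u₀ ρ₀)
include h hf

/-- The map (t, x) ↦ (t, φ(t, x)) is a continuous proper surjection, hence a quotient map, and
composing u with it gives the continuous function φ_t. -/
theorem continuous_uncurry : Continuous (Function.uncurry U) := by
  let Ψ : ℝ × ℝ → ℝ × ℝ := fun q => (q.1, geoPhi u₀ ρ₀ q.1 q.2)
  have hc : Continuous Ψ := continuous_fst.prodMk h.continuous_uncurry_geoPhi
  have hprop : IsProperMap Ψ := by
    refine isProperMap_iff_isCompact_preimage.2 ⟨hc, fun K hK => ?_⟩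
    obtain ⟨C, hC⟩ := hK.isBounded.exists_norm_le
    refine Metric.isCompact_of_isClosed_isBounded (hK.isClosed.preimage hc)
      (isBounded_iff_forall_norm_le.2 ⟨C + 1, fun q hq => ?_⟩)
    have h1 := hC _ hq
    have h2 := h.abs_geoPhi_sub_le q.1 q.2
    have h3 := (norm_fst_le (Ψ q)).trans h1
    have h4 := (norm_snd_le (Ψ q)).trans h1
    simp only [Ψ, Real.norm_eq_abs] at h3 h4
    rw [Prod.norm_def, max_le_iff, Real.norm_eq_abs, Real.norm_eq_abs]
    refine ⟨by linarith, ?_⟩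
    rw [abs_le] at *
    constructor <;> linarith [h2.1, h2.2, h4.1, h4.2]
  have hsurj : Function.Surjective Ψ := fun q => by
    obtain ⟨x, hx⟩ := h.surjective_geoPhi q.1 q.2
    exact ⟨(q.1, x), Prod.ext rfl hx⟩
  refine (hprop.isClosedMap.isQuotientMap hc hsurj).continuous_iff.2 ?_
  have : Function.uncurry U ∘ Ψ = Function.uncurry (geoPhiT u₀ ρ₀) :=
    funext fun q => (hf q.1).comp_u q.2
  rw [this]
  exact h.continuous_uncurry_geoPhiT

theorem exists_abs_le : ∃ K, 0 ≤ K ∧ ∀ t, ∀ y ∈ Icc (0 : ℝ) 1, |U t y| ≤ K := by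
  obtain ⟨K, hK, hb⟩ := h.exists_abs_le
  refine ⟨K, hK, fun t y hy => ?_⟩
  obtain ⟨x, hx, rfl⟩ := h.exists_geoPhi_eq t hy
  rw [(hf t).comp_u]
  exact (hb t x hx).1

theorem norm_sq_add_norm_sq_le (t : ℝ) :
    ‖toL2 (deriv (U t))‖ ^ 2 + ‖toL2 (R t)‖ ^ 2 ≤ 4 := by
  rw [norm_toL2_sq ((hf t).memLp_deriv h), norm_toL2_sq ((hf t).memLp_ρ h)]
  exact (hf t).normSq_add_normSq_le h

theorem normSq_add_normSq {t : ℝ} (ht : t ∉ exceptionalTimes u₀ ρ₀) :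
    normSq (deriv (U t)) + normSq (R t) = 4 := by
  rw [(hf t).normSq_add_normSq h, intervalIntegral.integral_of_le zero_le_one,
    integral_eq_zero_of_ae, mul_zero, sub_zero]
  filter_upwards [not_not.1 ht] with x hx
  simp [hx]

theorem norm_deriv_le (t : ℝ) : ‖toL2 (deriv (U t))‖ ≤ 2 := by
  have := hf.norm_sq_add_norm_sq_le h t
  exact (abs_le_of_sq_le_sq' (by nlinarith [sq_nonneg ‖toL2 (R t)‖]) zero_le_two).2

theorem norm_ρ_le (t : ℝ) : ‖toL2 (R t)‖ ≤ 2 := by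
  have := hf.norm_sq_add_norm_sq_le h t
  exact (abs_le_of_sq_le_sq' (by nlinarith [sq_nonneg ‖toL2 (deriv (U t))‖]) zero_le_two).2

/-- After the substitution y = φ(t, x) the division by φ_x disappears, and dominated convergence
gives weak continuity even at exceptional times. -/
theorem continuous_inner_deriv {θ : ℝ → ℝ} (hθ : IsTest θ) :
    Continuous fun t => inner ℝ (toL2 (deriv (U t))) (toL2 θ) := by
  obtain ⟨C, hC0, hC⟩ := hθ.2.exists_abs_le hθ.continuous
  have : (fun t => inner ℝ (toL2 (deriv (U t))) (toL2 θ)) = fun t =>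
      ∫ x in (0 : ℝ)..1, geoPhiTX u₀ ρ₀ t x * θ (geoPhi u₀ ρ₀ t x) := funext fun t => by
    rw [inner_toL2 ((hf t).memLp_deriv h) hθ.memLp, (hf t).integral_deriv_mul h hθ.continuous]
  rw [this]
  refine intervalIntegral.continuous_of_dominated_interval
    (bound := fun x => 4 * (1 + |deriv u₀ x| + |deriv u₀ x ^ 2 + ρ₀ x ^ 2|) * C)
    (fun t => ?_) (fun t => ae_of_all _ fun x _ => ?_) ?_ (ae_of_all _ fun x _ => ?_)
  · exact ((h.aemeasurable_geoPhiTX t).mul (hθ.continuous.comp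
      (h.continuous_geoPhi t)).aemeasurable).restrict.aestronglyMeasurable
  · rw [norm_mul]
    exact mul_le_mul (abs_geoPhiTX_le t x) (hC _) (norm_nonneg _) (by positivity)
  · exact (((intervalIntegrable_const.add (h.intervalIntegrable_deriv 0 1).abs).add
      (h.intervalIntegrable_energy 0 1).abs).const_mul 4).mul_const C
  · have h1 : Continuous fun t => geoPhi u₀ ρ₀ t x :=
      continuous_iff_continuousAt.2 fun t => (h.hasDerivAt_geoPhi t x).continuousAt
    have h2 := hθ.continuous
    unfold geoPhiTX
    fun_prop

/-- The time derivative of `ρ` against a test function. -/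
theorem hasDerivAt_inner_ρ {θ : ℝ → ℝ} (hθ : IsTest θ) : (∀ t,
    HasDerivAt (fun s => inner ℝ (toL2 (R s)) (toL2 θ))
      (inner ℝ (toL2 fun y => U t y * R t y) (toL2 (deriv θ))) t) ∧
    ∃ M, ∀ t, |inner ℝ (toL2 fun y => U t y * R t y) (toL2 (deriv θ))| ≤ M := by
  obtain ⟨C, hC0, hC⟩ := hθ.periodic_deriv.exists_abs_le hθ.continuous_deriv
  obtain ⟨K, hK0, hK⟩ := h.exists_abs_le
  have h1 : (fun t => inner ℝ (toL2 (R t)) (toL2 θ)) = fun t =>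
      ∫ x in (0 : ℝ)..1, ρ₀ x * θ (geoPhi u₀ ρ₀ t x) := funext fun t => by
    rw [inner_toL2 ((hf t).memLp_ρ h) hθ.memLp, (hf t).integral_ρ_mul h hθ.continuous]
  have h2 : ∀ t, inner ℝ (toL2 fun y => U t y * R t y) (toL2 (deriv θ)) = ∫ x in (0 : ℝ)..1,
      ρ₀ x * (deriv θ (geoPhi u₀ ρ₀ t x) * geoPhiT u₀ ρ₀ t x) := fun t => by
    have hcu := (hf t).continuous_u h
    rw [inner_toL2 (memLp_mul_of_continuous hcu ((hf t).memLp_ρ h)) hθ.memLp_deriv]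
    have := (hf t).integral_ρ_mul h (hθ.continuous_deriv.mul hcu)
    simp only [Pi.mul_apply, (hf t).comp_u] at this
    rw [← this]
    exact intervalIntegral.integral_congr fun y _ => by ring
  have hbound : ∀ t, ∀ x ∈ uIoc (0 : ℝ) 1,
      ‖ρ₀ x * (deriv θ (geoPhi u₀ ρ₀ t x) * geoPhiT u₀ ρ₀ t x)‖ ≤ |ρ₀ x| * (C * K) :=
    fun t x hx => by
      rw [uIoc_of_le zero_le_one] at hx
      rw [norm_mul, norm_mul]
      have := (hK t x (Ioc_subset_Icc_self hx)).1
      have := hC (geoPhi u₀ ρ₀ t x)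
      simp only [Real.norm_eq_abs]
      gcongr
  have hbi : IntervalIntegrable (fun x => |ρ₀ x| * (C * K)) volume 0 1 :=
    (h.intervalIntegrable_ρ 0 1).abs.mul_const _
  constructor
  · intro t
    rw [h1, h2]
    refine (intervalIntegral.hasDerivAt_integral_of_dominated_loc_of_deriv_le
      (F := fun s x => ρ₀ x * θ (geoPhi u₀ ρ₀ s x))
      (F' := fun s x => ρ₀ x * (deriv θ (geoPhi u₀ ρ₀ s x) * geoPhiT u₀ ρ₀ s x))
      (bound := fun x => |ρ₀ x| * (C * K)) univ_mem
      (Eventually.of_forall fun s => ?_) ?_ ?_ (ae_of_all _ fun x hx s _ => hbound s x hx) hbi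
      (ae_of_all _ fun x _ s _ => ?_)).2
    · exact (h.aemeasurable_ρ.mul (hθ.continuous.comp
        (h.continuous_geoPhi s)).aemeasurable).restrict.aestronglyMeasurable
    · exact (h.intervalIntegrable_ρ 0 1).mul_continuousOn
        (hθ.continuous.comp (h.continuous_geoPhi t)).continuousOn
    · have h4 : Continuous fun x => deriv θ (geoPhi u₀ ρ₀ t x) * geoPhiT u₀ ρ₀ t x :=
        (hθ.continuous_deriv.comp (h.continuous_geoPhi t)).mul (h.continuous_geoPhiT t)
      have h5 : AEMeasurable fun x => ρ₀ x * (deriv θ (geoPhi u₀ ρ₀ t x) * geoPhiT u₀ ρ₀ t x) :=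
        h.aemeasurable_ρ.mul h4.aemeasurable
      exact h5.restrict.aestronglyMeasurable
    · have h3 := HasDerivAt.comp s (h₂ := θ) (h := fun s => geoPhi u₀ ρ₀ s x)
        (hθ.differentiable _).hasDerivAt (h.hasDerivAt_geoPhi s x)
      exact h3.const_mul (ρ₀ x)
  · refine ⟨∫ x in (0 : ℝ)..1, |ρ₀ x| * (C * K), fun t => ?_⟩
    rw [h2, ← Real.norm_eq_abs]
    refine intervalIntegral.norm_integral_le_of_norm_le zero_le_one (ae_of_all _ fun x hx => ?_) hbi
    exact hbound t x (by rwa [uIoc_of_le zero_le_one])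

end IsFlow

/-! ### The source term, strong continuity, and the tested equation for u. -/

theorem norm_toL2_abs {f : ℝ → ℝ} (hf : MemLp f 2 circleMeasure) :
    ‖toL2 fun x => |f x|‖ = ‖toL2 f‖ := by
  have h1 : ‖toL2 fun x => |f x|‖ ^ 2 = ‖toL2 f‖ ^ 2 := by
    have h2 : MemLp (fun x => |f x|) 2 circleMeasure := hf.abs
    rw [norm_toL2_sq hf, norm_toL2_sq h2, normSq, normSq]
    simp only [sq_abs]
  exact (pow_left_inj₀ (norm_nonneg _) (norm_nonneg _) two_ne_zero).1 h1

/-- Cauchy–Schwarz for |f − g| |f + g|. It converts strong L² continuity into L¹ continuity of the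
energy density. -/
theorem integral_abs_sq_sub_sq_le {f g : ℝ → ℝ} (hf : MemLp f 2 circleMeasure)
    (hg : MemLp g 2 circleMeasure) : ∫ x in (0 : ℝ)..1, |f x ^ 2 - g x ^ 2| ≤
      ‖toL2 f - toL2 g‖ * (‖toL2 f‖ + ‖toL2 g‖) := by
  have h1 : MemLp (fun x => f x - g x) 2 circleMeasure := hf.sub hg
  have h2 : MemLp (fun x => f x + g x) 2 circleMeasure := hf.add hg
  calc ∫ x in (0 : ℝ)..1, |f x ^ 2 - g x ^ 2|
      = inner ℝ (toL2 fun x => |f x - g x|) (toL2 fun x => |f x + g x|) := by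
        have h3 : MemLp (fun x => |f x - g x|) 2 circleMeasure := h1.abs
        have h4 : MemLp (fun x => |f x + g x|) 2 circleMeasure := h2.abs
        rw [inner_toL2 h3 h4]
        refine intervalIntegral.integral_congr fun x _ => ?_
        rw [← abs_mul]
        congr 1
        ring
    _ ≤ ‖toL2 fun x => |f x - g x|‖ * ‖toL2 fun x => |f x + g x|‖ := real_inner_le_norm _ _
    _ = ‖toL2 f - toL2 g‖ * ‖toL2 f + toL2 g‖ := by
        rw [norm_toL2_abs h1, norm_toL2_abs h2, toL2_sub hf hg, toL2_add hf hg]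
    _ ≤ _ := mul_le_mul_of_nonneg_left (norm_add_le _ _) (norm_nonneg _)

/-- The source term of the equation for `u`. -/
noncomputable def source (v r : ℝ → ℝ) (x : ℝ) : ℝ :=
  1 / 2 * ((∫ y in (0 : ℝ)..x, (deriv v y ^ 2 + r y ^ 2)) -
    x * ∫ y in (0 : ℝ)..1, (deriv v y ^ 2 + r y ^ 2))

namespace IsFlowAt

variable {t : ℝ} {v r : ℝ → ℝ} (hf : IsFlowAt u₀ ρ₀ t v r) (h : IsUnitData u₀ ρ₀)
include h hf

theorem continuous_source : Continuous (source v r) := by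
  have := hf.continuous_integral_energy h
  unfold source
  fun_prop

theorem abs_source_le {y : ℝ} (hy : y ∈ Icc (0 : ℝ) 1) : |source v r y| ≤ 2 := by
  have h1 : ∫ z in (0 : ℝ)..1, (deriv v z ^ 2 + r z ^ 2) ≤ 4 := by
    rw [← hf.normSq_add_normSq_eq_integral h]
    exact hf.normSq_add_normSq_le h
  have h2 : ∫ z in (0 : ℝ)..y, (deriv v z ^ 2 + r z ^ 2) ≤
      ∫ z in (0 : ℝ)..1, (deriv v z ^ 2 + r z ^ 2) :=
    intervalIntegral.integral_mono_interval le_rfl hy.1 hy.2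
      (ae_of_all _ fun z => by simp only [Pi.zero_apply]; positivity)
      (hf.intervalIntegrable_energy h)
  have h3 : 0 ≤ ∫ z in (0 : ℝ)..y, (deriv v z ^ 2 + r z ^ 2) :=
    intervalIntegral.integral_nonneg hy.1 fun z _ => by positivity
  unfold source
  rw [abs_le]
  constructor <;> nlinarith [hy.1, hy.2]

theorem abs_source_sub_le {t' : ℝ} {v' r' : ℝ → ℝ} (hf' : IsFlowAt u₀ ρ₀ t' v' r') {y : ℝ}
    (hy : y ∈ Icc (0 : ℝ) 1) : |source v r y - source v' r' y| ≤
      ∫ z in (0 : ℝ)..1, |(deriv v z ^ 2 + r z ^ 2) - (deriv v' z ^ 2 + r' z ^ 2)| := by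
  have hi := (hf.intervalIntegrable_energy h).sub (hf'.intervalIntegrable_energy h)
  have hsub : uIcc (0 : ℝ) y ⊆ uIcc 0 1 := by
    rw [uIcc_of_le hy.1, uIcc_of_le zero_le_one]
    exact Icc_subset_Icc_right hy.2
  have h1 : |∫ z in (0 : ℝ)..1, ((deriv v z ^ 2 + r z ^ 2) - (deriv v' z ^ 2 + r' z ^ 2))| ≤
      ∫ z in (0 : ℝ)..1, |(deriv v z ^ 2 + r z ^ 2) - (deriv v' z ^ 2 + r' z ^ 2)| :=
    intervalIntegral.abs_integral_le_integral_abs zero_le_one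
  have h2 : |∫ z in (0 : ℝ)..y, ((deriv v z ^ 2 + r z ^ 2) - (deriv v' z ^ 2 + r' z ^ 2))| ≤
      ∫ z in (0 : ℝ)..1, |(deriv v z ^ 2 + r z ^ 2) - (deriv v' z ^ 2 + r' z ^ 2)| :=
    (intervalIntegral.abs_integral_le_integral_abs hy.1).trans
      (intervalIntegral.integral_mono_interval le_rfl hy.1 hy.2
        (ae_of_all _ fun z => abs_nonneg _) hi.abs)
  rw [intervalIntegral.integral_sub (hf.intervalIntegrable_energy h)
    (hf'.intervalIntegrable_energy h)] at h1
  rw [intervalIntegral.integral_sub ((hf.intervalIntegrable_energy h).mono_set hsub)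
    ((hf'.intervalIntegrable_energy h).mono_set hsub)] at h2
  unfold source
  rw [abs_le] at h1 h2 ⊢
  constructor <;> nlinarith [hy.1, hy.2, h1.1, h1.2, h2.1, h2.2]

/-- Away from the exceptional times the source term is the acceleration of the flow. -/
theorem source_comp (ht : t ∉ exceptionalTimes u₀ ρ₀) {x : ℝ} (hx : x ∈ Icc (0 : ℝ) 1) :
    source v r (geoPhi u₀ ρ₀ t x) = geoPhiTT u₀ ρ₀ t x := by
  have hp : ∀ᵐ z ∂(volume.restrict (Ioc (0 : ℝ) 1)), geoPhiX u₀ ρ₀ t z ≠ 0 := not_not.1 ht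
  have hint : ∀ z ∈ Icc (0 : ℝ) 1, ∫ y in (0 : ℝ)..geoPhi u₀ ρ₀ t z, (deriv v y ^ 2 + r y ^ 2) =
      4 * ∫ y in (0 : ℝ)..z, geoQ u₀ ρ₀ t y := fun z hz => by
    rw [hf.integral_energy h hz.1, ← intervalIntegral.integral_const_mul,
      intervalIntegral.integral_of_le hz.1, intervalIntegral.integral_of_le hz.1]
    refine integral_congr_ae ?_
    filter_upwards [ae_restrict_of_ae_restrict_of_subset (Ioc_subset_Ioc_right hz.2) hp] with y hy
    exact indicator_of_mem (by exact hy) _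
  have h1 := hint x hx
  have h2 := hint 1 ⟨zero_le_one, le_rfl⟩
  have hu1 : u₀ 1 = 0 := by simpa [h.zero] using h.periodic_u 0
  rw [h.integral_geoQ] at h1
  rw [h.geoPhi_one, h.integral_geoQ, hu1, h.cumEnergy_one] at h2
  -- As the total energy is 4, the source at φ is 2(∫₀ˣ q − φ). This is φ_tt, because (f, g)_tt =
  -- −(f, g) gives φ_ttx = 2q − 2φ_x.
  unfold source
  rw [h1, h2, h.geoPhi_eq]
  unfold geoPhiTT
  linear_combination (-2 * (Real.cos t ^ 2 * x + Real.sin t * Real.cos t * u₀ x +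
    Real.sin t ^ 2 / 4 * cumEnergy u₀ ρ₀ x)) * Real.sin_sq_add_cos_sq t

/-- Integration by parts on the circle. -/
theorem integral_sq_mul_deriv {θ : ℝ → ℝ} (hθ : IsTest θ) :
    ∫ y in (0 : ℝ)..1, v y ^ 2 * deriv θ y = -2 * ∫ y in (0 : ℝ)..1, deriv v y * (v y * θ y) := by
  have hac := hf.absolutelyContinuous h
  have hcont := hf.continuous_u h
  have hθac : AbsolutelyContinuousOnInterval θ 0 1 :=
    ((hθ.1.of_le (m := 1) (by simp)).contDiffOn).absolutelyContinuousOnInterval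
  have h1 := (hac.fun_mul hac).integral_deriv_mul_eq_sub hθac
  have h2 : θ 1 = θ 0 := by simpa using hθ.2 0
  have h3 : v 1 = v 0 := by simpa using hf.periodic_u 0
  rw [h2, h3, sub_self] at h1
  have hi1 : IntervalIntegrable (fun y => v y ^ 2 * deriv θ y) volume 0 1 :=
    ((hcont.pow 2).mul hθ.continuous_deriv).intervalIntegrable 0 1
  have hi2 : IntervalIntegrable (fun y => deriv v y * (v y * θ y)) volume 0 1 :=
    hac.intervalIntegrable_deriv.mul_continuousOn (hcont.mul hθ.continuous).continuousOn
  have h4 : ∫ y in (0 : ℝ)..1, (v y ^ 2 * deriv θ y + 2 * (deriv v y * (v y * θ y))) = 0 := by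
    refine Eq.trans (intervalIntegral.integral_congr_ae ?_) h1
    filter_upwards [hac.ae_differentiableAt] with y hy hmem
    have hd : HasDerivAt v (deriv v y) y := (hy (uIoc_subset_uIcc hmem)).hasDerivAt
    have hd' : HasDerivAt (fun x => v x * v x) (deriv v y * v y + v y * deriv v y) y := hd.mul hd
    rw [hd'.deriv]
    ring
  rw [intervalIntegral.integral_add hi1 (hi2.const_mul 2), intervalIntegral.integral_const_mul] at h4
  linarith

end IsFlowAt

namespace IsFlow

variable {U R : ℝ → ℝ → ℝ} (hf : IsFlow u₀ ρ₀ U R) (h : IsUnitData u₀ ρ₀)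
include h hf

/-- Strong continuity of `(uₓ, ρ)` away from the exceptional times. -/
theorem continuousAt_toL2 {t : ℝ} (ht : t ∉ exceptionalTimes u₀ ρ₀) :
    ContinuousAt (fun s => toL2 (deriv (U s))) t ∧ ContinuousAt (fun s => toL2 (R s)) t := by
  refine tendsto_norm_sq_of_weak (hf.norm_sq_add_norm_sq_le h) ?_
    (fun θ hθ => (hf.continuous_inner_deriv h hθ).continuousAt)
    (fun θ hθ => ((hf.hasDerivAt_inner_ρ h hθ).1 t).continuousAt)
  rw [norm_toL2_sq ((hf t).memLp_deriv h), norm_toL2_sq ((hf t).memLp_ρ h)]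
  exact hf.normSq_add_normSq h ht

/-- Split the difference as u_s(z_s − z_t) + (u_s − u_t) z_t: the first part is small in L², the
second because u_s → u_t uniformly on [0, 1]. -/
theorem continuousAt_toL2_mul {z : ℝ → ℝ → ℝ} (hz : ∀ s, MemLp (z s) 2 circleMeasure) {t : ℝ}
    (hc : ContinuousAt (fun s => toL2 (z s)) t) :
    ContinuousAt (fun s => toL2 fun y => U s y * z s y) t := by
  obtain ⟨K, hK0, hK⟩ := hf.exists_abs_le h
  have hcu : ∀ s, Continuous (U s) := fun s => (hf s).continuous_u h
  set N := ‖toL2 (z t)‖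
  rw [Metric.continuousAt_iff'] at hc ⊢
  intro ε hε
  obtain ⟨V, hV, hV'⟩ := (isCompact_Icc (a := (0 : ℝ)) (b := 1)).mem_uniformity_of_prod
    (f := U) (s := univ) (q := t) (hf.continuous_uncurry h).continuousOn (mem_univ t)
    (Metric.dist_mem_uniformity (show 0 < ε / (2 * (N + 1)) by positivity))
  rw [nhdsWithin_univ] at hV
  filter_upwards [hc (ε / (2 * (K + 1))) (by positivity), hV] with s hs hsV
  have hzd : MemLp (fun y => z s y - z t y) 2 circleMeasure := (hz s).sub (hz t)
  have hcd : Continuous fun y => U s y - U t y := (hcu s).sub (hcu t)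
  have h1 : (toL2 fun y => U s y * z s y) - (toL2 fun y => U t y * z t y) =
      (toL2 fun y => U s y * (z s y - z t y)) + toL2 fun y => (U s y - U t y) * z t y := by
    rw [← toL2_sub (memLp_mul_of_continuous (hcu s) (hz s))
      (memLp_mul_of_continuous (hcu t) (hz t)),
      ← toL2_add (memLp_mul_of_continuous (hcu s) hzd)
      (memLp_mul_of_continuous hcd (hz t))]
    congr 1
    funext y
    ring
  have h2 := norm_toL2_mul_le (hcu s) hzd (hK s)
  have h3 := norm_toL2_mul_le hcd (hz t) (C := ε / (2 * (N + 1))) fun x hx => (hV' s hsV x hx).le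
  rw [toL2_sub (hz s) (hz t)] at h2
  rw [dist_eq_norm, lt_div_iff₀ (by positivity)] at hs
  rw [dist_eq_norm, h1]
  have h5 : ε / (2 * (N + 1)) * N < ε / 2 := by
    have hN : 0 ≤ N := norm_nonneg _
    rw [div_mul_eq_mul_div, div_lt_div_iff₀ (by positivity) two_pos]
    nlinarith
  have h6 : K * ‖toL2 (z s) - toL2 (z t)‖ ≤ ε / 2 := by
    nlinarith [norm_nonneg (toL2 (z s) - toL2 (z t))]
  refine (norm_add_le _ _).trans_lt ?_
  linarith

theorem continuousAt_toL2_source {t : ℝ} (ht : t ∉ exceptionalTimes u₀ ρ₀) :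
    ContinuousAt (fun s => toL2 (source (U s) (R s))) t := by
  obtain ⟨hX, hY⟩ := hf.continuousAt_toL2 h ht
  have h1 := tendsto_iff_norm_sub_tendsto_zero.1 hX
  have h2 := tendsto_iff_norm_sub_tendsto_zero.1 hY
  -- The factor 4 bounds the sum of two L² norms, each at most 2.
  have h3 := (h1.add h2).const_mul 4
  rw [add_zero, mul_zero] at h3
  refine tendsto_iff_norm_sub_tendsto_zero.2 (squeeze_zero (fun _ => norm_nonneg _)
    (fun s => ?_) h3)
  have hi : ∀ s t, IntervalIntegrable (fun z => |deriv (U s) z ^ 2 - deriv (U t) z ^ 2|)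
      volume 0 1 := fun s t => by
    rw [intervalIntegrable_iff_integrableOn_Ioc_of_le zero_le_one]
    exact (((hf s).memLp_deriv h).integrable_sq.sub ((hf t).memLp_deriv h).integrable_sq).abs
  have hi' : ∀ s t, IntervalIntegrable (fun z => |R s z ^ 2 - R t z ^ 2|) volume 0 1 :=
    fun s t => by
      rw [intervalIntegrable_iff_integrableOn_Ioc_of_le zero_le_one]
      exact (((hf s).memLp_ρ h).integrable_sq.sub ((hf t).memLp_ρ h).integrable_sq).abs
  rw [← toL2_sub (memLp_of_continuous ((hf s).continuous_source h))
    (memLp_of_continuous ((hf t).continuous_source h))]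
  have h4 : ∫ z in (0 : ℝ)..1, |(deriv (U s) z ^ 2 + R s z ^ 2) -
      (deriv (U t) z ^ 2 + R t z ^ 2)| ≤
      4 * (‖toL2 (deriv (U s)) - toL2 (deriv (U t))‖ + ‖toL2 (R s) - toL2 (R t)‖) := by
    calc _ ≤ ∫ z in (0 : ℝ)..1, (|deriv (U s) z ^ 2 - deriv (U t) z ^ 2| +
          |R s z ^ 2 - R t z ^ 2|) := by
          refine intervalIntegral.integral_mono_on zero_le_one
            (((hf s).intervalIntegrable_energy h).sub ((hf t).intervalIntegrable_energy h)).abs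
            ((hi s t).add (hi' s t)) fun z _ => ?_
          rw [add_sub_add_comm]
          exact abs_add_le _ _
      _ ≤ _ := by
          rw [intervalIntegral.integral_add (hi s t) (hi' s t), mul_add]
          refine add_le_add
            ((integral_abs_sq_sub_sq_le ((hf s).memLp_deriv h) ((hf t).memLp_deriv h)).trans ?_)
            ((integral_abs_sq_sub_sq_le ((hf s).memLp_ρ h) ((hf t).memLp_ρ h)).trans ?_)
          · rw [mul_comm]
            refine mul_le_mul_of_nonneg_right ?_ (norm_nonneg _)
            linarith [hf.norm_deriv_le h s, hf.norm_deriv_le h t]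
          · rw [mul_comm]
            refine mul_le_mul_of_nonneg_right ?_ (norm_nonneg _)
            linarith [hf.norm_ρ_le h s, hf.norm_ρ_le h t]
  refine (norm_toL2_le ?_ fun y hy => (hf s).abs_source_sub_le h (hf t) hy).trans h4
  exact intervalIntegral.integral_nonneg zero_le_one fun _ _ => abs_nonneg _

/-- The time derivative of `u` against a test function. -/
theorem hasDerivAt_inner_u {θ : ℝ → ℝ} (hθ : IsTest θ) : ∃ D : ℝ → ℝ,
    (∀ t, HasDerivAt (fun s => inner ℝ (toL2 (U s)) (toL2 θ)) (D t) t) ∧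
    (∃ M, ∀ t, |D t| ≤ M) ∧ ∀ t, t ∉ exceptionalTimes u₀ ρ₀ →
      D t = inner ℝ (toL2 (source (U t) (R t)) - toL2 fun y => U t y * deriv (U t) y)
        (toL2 θ) := by
  obtain ⟨C, hC0, hC⟩ := hθ.2.exists_abs_le hθ.continuous
  obtain ⟨C', hC'0, hC'⟩ := hθ.periodic_deriv.exists_abs_le hθ.continuous_deriv
  obtain ⟨K, hK0, hK⟩ := h.exists_abs_le
  -- `G` is the integrand of ⟨u, θ⟩ after substituting y = φ(t, x), `G'` its time derivative, and
  -- `B` a dominating function independent of t.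
  let G : ℝ → ℝ → ℝ := fun t x =>
    geoPhiT u₀ ρ₀ t x * θ (geoPhi u₀ ρ₀ t x) * geoPhiX u₀ ρ₀ t x
  let G' : ℝ → ℝ → ℝ := fun t x =>
    (geoPhiTT u₀ ρ₀ t x * θ (geoPhi u₀ ρ₀ t x) +
      geoPhiT u₀ ρ₀ t x * (deriv θ (geoPhi u₀ ρ₀ t x) * geoPhiT u₀ ρ₀ t x)) * geoPhiX u₀ ρ₀ t x +
      geoPhiT u₀ ρ₀ t x * θ (geoPhi u₀ ρ₀ t x) * geoPhiTX u₀ ρ₀ t x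
  let B : ℝ → ℝ := fun x => (K * C + K * (C' * K)) * (1 + (deriv u₀ x ^ 2 + ρ₀ x ^ 2) / 4) +
    K * C * (4 * (1 + |deriv u₀ x| + |deriv u₀ x ^ 2 + ρ₀ x ^ 2|))
  have hBi : IntervalIntegrable B volume 0 1 :=
    ((intervalIntegrable_const.add ((h.intervalIntegrable_energy 0 1).div_const 4)).const_mul
      _).add ((((intervalIntegrable_const.add (h.intervalIntegrable_deriv 0 1).abs).add
      (h.intervalIntegrable_energy 0 1).abs).const_mul 4).const_mul _)
  have hbound : ∀ t, ∀ x ∈ uIoc (0 : ℝ) 1, ‖G' t x‖ ≤ B x := fun t x hx => by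
    rw [uIoc_of_le zero_le_one] at hx
    have h1 := (hK t x (Ioc_subset_Icc_self hx)).1
    have h2 := (hK t x (Ioc_subset_Icc_self hx)).2
    have h3 := hC (geoPhi u₀ ρ₀ t x)
    have h4 := hC' (geoPhi u₀ ρ₀ t x)
    have h5 := abs_geoPhiTX_le (u₀ := u₀) (ρ₀ := ρ₀) t x
    have h6 : |geoPhiX u₀ ρ₀ t x| ≤ 1 + (deriv u₀ x ^ 2 + ρ₀ x ^ 2) / 4 := by
      rw [abs_of_nonneg (geoPhiX_nonneg t x), ← geoPhiX_add_geoQ t x]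
      linarith [geoQ_nonneg (u₀ := u₀) (ρ₀ := ρ₀) t x]
    have h7 : |geoPhiTT u₀ ρ₀ t x * θ (geoPhi u₀ ρ₀ t x) + geoPhiT u₀ ρ₀ t x *
        (deriv θ (geoPhi u₀ ρ₀ t x) * geoPhiT u₀ ρ₀ t x)| ≤ K * C + K * (C' * K) := by
      refine (abs_add_le _ _).trans ?_
      rw [abs_mul, abs_mul, abs_mul]
      gcongr
    simp only [G', B, Real.norm_eq_abs]
    refine (abs_add_le _ _).trans ?_
    rw [abs_mul, abs_mul _ (geoPhiTX u₀ ρ₀ t x), abs_mul _ (θ _)]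
    gcongr
  have hcθ : ∀ t, Continuous fun x => θ (geoPhi u₀ ρ₀ t x) := fun t =>
    hθ.continuous.comp (h.continuous_geoPhi t)
  have hcθ' : ∀ t, Continuous fun x => deriv θ (geoPhi u₀ ρ₀ t x) := fun t =>
    hθ.continuous_deriv.comp (h.continuous_geoPhi t)
  have hc1 : ∀ t, Continuous fun x => geoPhiT u₀ ρ₀ t x * θ (geoPhi u₀ ρ₀ t x) := fun t =>
    (h.continuous_geoPhiT t).mul (hcθ t)
  have hc2 : ∀ t, Continuous fun x => geoPhiTT u₀ ρ₀ t x * θ (geoPhi u₀ ρ₀ t x) := fun t =>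
    (h.continuous_geoPhiTT t).mul (hcθ t)
  have hc3 : ∀ t, Continuous fun x => geoPhiT u₀ ρ₀ t x *
      (deriv θ (geoPhi u₀ ρ₀ t x) * geoPhiT u₀ ρ₀ t x) := fun t =>
    (h.continuous_geoPhiT t).mul ((hcθ' t).mul (h.continuous_geoPhiT t))
  have hGi : ∀ t, IntervalIntegrable (G t) volume 0 1 := fun t =>
    (h.intervalIntegrable_geoPhiX t 0 1).continuousOn_mul (hc1 t).continuousOn
  have hi2 : ∀ t, IntervalIntegrable (fun x => geoPhiTT u₀ ρ₀ t x * θ (geoPhi u₀ ρ₀ t x) *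
      geoPhiX u₀ ρ₀ t x) volume 0 1 := fun t =>
    (h.intervalIntegrable_geoPhiX t 0 1).continuousOn_mul (hc2 t).continuousOn
  have hi3 : ∀ t, IntervalIntegrable (fun x => geoPhiT u₀ ρ₀ t x *
      (deriv θ (geoPhi u₀ ρ₀ t x) * geoPhiT u₀ ρ₀ t x) * geoPhiX u₀ ρ₀ t x) volume 0 1 := fun t =>
    (h.intervalIntegrable_geoPhiX t 0 1).continuousOn_mul (hc3 t).continuousOn
  have hi4 : ∀ t, IntervalIntegrable (fun x => geoPhiT u₀ ρ₀ t x * θ (geoPhi u₀ ρ₀ t x) *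
      geoPhiTX u₀ ρ₀ t x) volume 0 1 := fun t =>
    (h.intervalIntegrable_geoPhiTX t 0 1).continuousOn_mul (hc1 t).continuousOn
  have hG'eq : ∀ t, G' t = fun x => geoPhiTT u₀ ρ₀ t x * θ (geoPhi u₀ ρ₀ t x) *
      geoPhiX u₀ ρ₀ t x + geoPhiT u₀ ρ₀ t x * (deriv θ (geoPhi u₀ ρ₀ t x) * geoPhiT u₀ ρ₀ t x) *
      geoPhiX u₀ ρ₀ t x + geoPhiT u₀ ρ₀ t x * θ (geoPhi u₀ ρ₀ t x) * geoPhiTX u₀ ρ₀ t x :=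
    fun t => funext fun x => by simp only [G']; ring
  have hG'i : ∀ t, IntervalIntegrable (G' t) volume 0 1 := fun t => by
    rw [hG'eq]
    exact ((hi2 t).add (hi3 t)).add (hi4 t)
  have hsubst : ∀ t, ∀ {k : ℝ → ℝ}, Continuous k → ∫ y in (0 : ℝ)..1, k y =
      ∫ x in (0 : ℝ)..1, k (geoPhi u₀ ρ₀ t x) * geoPhiX u₀ ρ₀ t x := fun t k hk => by
    have := h.integral_comp_geoPhi t zero_le_one (k := k) hk.aestronglyMeasurable
    rwa [IsUnitData.geoPhi_zero, h.geoPhi_one] at this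
  have hpair : (fun t => inner ℝ (toL2 (U t)) (toL2 θ)) = fun t => ∫ x in (0 : ℝ)..1, G t x :=
    funext fun t => by
      have hcu := (hf t).continuous_u h
      rw [inner_toL2 (memLp_of_continuous hcu) hθ.memLp, hsubst t (k := fun y => U t y * θ y) (hcu.mul hθ.continuous)]
      simp only [(hf t).comp_u, G]
  refine ⟨fun t => ∫ x in (0 : ℝ)..1, G' t x, fun t => ?_, ⟨∫ x in (0 : ℝ)..1, B x, fun t => ?_⟩,
    fun t ht => ?_⟩
  · rw [hpair]
    refine (intervalIntegral.hasDerivAt_integral_of_dominated_loc_of_deriv_le (F := G) (F' := G')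
      (bound := B) univ_mem (Eventually.of_forall fun s => ?_) (hGi t) ?_
      (ae_of_all _ fun x hx s _ => hbound s x hx) hBi (ae_of_all _ fun x _ s _ => ?_)).2
    · rw [uIoc_of_le zero_le_one]; exact (hGi s).1.aestronglyMeasurable
    · rw [uIoc_of_le zero_le_one]; exact (hG'i t).1.aestronglyMeasurable
    · have h3 := HasDerivAt.comp s (h₂ := θ) (h := fun s => geoPhi u₀ ρ₀ s x)
        (hθ.differentiable _).hasDerivAt (h.hasDerivAt_geoPhi s x)
      exact ((IsUnitData.hasDerivAt_geoPhiT s x).mul h3).mul (IsUnitData.hasDerivAt_geoPhiX s x)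
  · rw [← Real.norm_eq_abs]
    refine intervalIntegral.norm_integral_le_of_norm_le zero_le_one (ae_of_all _ fun x hx => ?_) hBi
    exact hbound t x (by rwa [uIoc_of_le zero_le_one])
  · have hcu := (hf t).continuous_u h
    have hcs := (hf t).continuous_source h
    have e1 : ∫ x in (0 : ℝ)..1, geoPhiTT u₀ ρ₀ t x * θ (geoPhi u₀ ρ₀ t x) * geoPhiX u₀ ρ₀ t x =
        ∫ y in (0 : ℝ)..1, source (U t) (R t) y * θ y := by
      rw [hsubst t (k := fun y => source (U t) (R t) y * θ y) (hcs.mul hθ.continuous)]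
      refine intervalIntegral.integral_congr fun x hx => ?_
      rw [uIcc_of_le zero_le_one] at hx
      simp only [(hf t).source_comp h ht hx]
    have e2 : ∫ x in (0 : ℝ)..1, geoPhiT u₀ ρ₀ t x *
        (deriv θ (geoPhi u₀ ρ₀ t x) * geoPhiT u₀ ρ₀ t x) * geoPhiX u₀ ρ₀ t x =
        ∫ y in (0 : ℝ)..1, U t y ^ 2 * deriv θ y := by
      rw [hsubst t (k := fun y => U t y ^ 2 * deriv θ y) ((hcu.pow 2).mul hθ.continuous_deriv)]
      refine intervalIntegral.integral_congr fun x _ => ?_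
      simp only [(hf t).comp_u]
      ring
    have e3 : ∫ x in (0 : ℝ)..1, geoPhiT u₀ ρ₀ t x * θ (geoPhi u₀ ρ₀ t x) *
        geoPhiTX u₀ ρ₀ t x = ∫ y in (0 : ℝ)..1, deriv (U t) y * (U t y * θ y) := by
      rw [(hf t).integral_deriv_mul h (θ := fun y => U t y * θ y) (hcu.mul hθ.continuous)]
      refine intervalIntegral.integral_congr fun x _ => ?_
      simp only [(hf t).comp_u]
      ring
    have e4 : inner ℝ (toL2 fun y => U t y * deriv (U t) y) (toL2 θ) =
        ∫ y in (0 : ℝ)..1, deriv (U t) y * (U t y * θ y) := by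
      rw [inner_toL2 (memLp_mul_of_continuous hcu ((hf t).memLp_deriv h)) hθ.memLp]
      exact intervalIntegral.integral_congr fun y _ => by ring
    -- The three terms are the source, ∫ u² θ' and ∫ u u_x θ. Integration by parts makes the second
    -- −2 ∫ u u_x θ, leaving the source minus u u_x.
    simp only [hG'eq]
    rw [intervalIntegral.integral_add ((hi2 t).add (hi3 t)) (hi4 t),
      intervalIntegral.integral_add (hi2 t) (hi3 t), e1, e2, e3, inner_sub_left,
      inner_toL2 (memLp_of_continuous hcs) hθ.memLp, e4, (hf t).integral_sq_mul_deriv h hθ]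
    ring

end IsFlow

/-! ### From tested equations to derivatives in L² and H⁻¹. -/

theorem continuous_weakDx : Continuous weakDx := by
  unfold weakDx
  exact ((innerSL ℝ).continuous.clm_comp continuous_const).neg

theorem exists_norm_weakDx_le : ∃ C, 0 ≤ C ∧ ∀ f, ‖weakDx f‖ ≤ ‖f‖ * C := by
  refine ⟨‖(WithLp.sndL 2 ℝ L2Circle L2Circle).comp H1Circle.subtypeL‖,
    ContinuousLinearMap.opNorm_nonneg _,
    fun f => ?_⟩
  rw [weakDx, ContinuousLinearMap.opNorm_neg]
  refine (ContinuousLinearMap.opNorm_comp_le _ _).trans ?_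
  rw [innerSL_apply_norm]

theorem absolutelyContinuousOnInterval_of_dist_le {E : Type*} [PseudoMetricSpace E]
    {X : ℝ → E} {C T : ℝ} (hT : 0 ≤ T)
    (hX : ∀ s t, 0 ≤ s → 0 ≤ t → dist (X t) (X s) ≤ C * |t - s|) :
    AbsolutelyContinuousOnInterval X 0 T := by
  have : LipschitzOnWith C.toNNReal X (uIcc 0 T) := by
    rw [uIcc_of_le hT]
    refine LipschitzOnWith.of_dist_le_mul fun x hx y hy => ?_
    rw [Real.dist_eq]
    exact (hX y x hy.1 hx.1).trans
      (mul_le_mul_of_nonneg_right (Real.le_coe_toNNReal C) (abs_nonneg _))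
  exact this.absolutelyContinuousOnInterval

theorem aestronglyMeasurable_of_continuousAt_off_countable {E : Type*} [TopologicalSpace E]
    [TopologicalSpace.PseudoMetrizableSpace E] {X : ℝ → E} {S : Set ℝ} (hS : S.Countable)
    (hX : ∀ t, t ∉ S → ContinuousAt X t) : AEStronglyMeasurable X volume := by
  have h1 : ContinuousOn X Sᶜ := fun t ht => (hX t ht).continuousWithinAt
  have h2 := h1.aestronglyMeasurable (μ := volume) hS.measurableSet.compl
  rwa [Measure.restrict_eq_self_of_ae_mem (show ∀ᵐ t, t ∈ Sᶜ from hS.ae_notMem volume)] at h2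

namespace IsFlow

variable {U R : ℝ → ℝ → ℝ} (hf : IsFlow u₀ ρ₀ U R) (h : IsUnitData u₀ ρ₀)
include h hf

theorem tested_u (i : {θ : ℝ → ℝ // IsTest θ}) : ∃ D : ℝ → ℝ,
    (∀ t, HasDerivAt (fun s => innerSL ℝ (toL2 i.1) (toL2 (U s))) (D t) t) ∧
    (∃ M, ∀ t, |D t| ≤ M) ∧ ∀ t, t ∉ exceptionalTimes u₀ ρ₀ →
      D t = innerSL ℝ (toL2 i.1)
        (toL2 (source (U t) (R t)) - toL2 fun y => U t y * deriv (U t) y) := by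
  simp only [innerSL_apply_apply]
  simpa only [real_inner_comm] using hf.hasDerivAt_inner_u h i.2

/-- The functionals on H⁻¹ are evaluations at smooth elements (θ, θ') of H¹: the embedding of L²
sees the first component, the weak derivative the second. -/
theorem tested_ρ (i : testH1) : ∃ D : ℝ → ℝ,
    (∀ t, HasDerivAt (fun s => ContinuousLinearMap.apply ℝ ℝ i.1 (toHNegOne (toL2 (R s))))
      (D t) t) ∧
    (∃ M, ∀ t, |D t| ≤ M) ∧ ∀ t, t ∉ exceptionalTimes u₀ ρ₀ →
      D t = ContinuousLinearMap.apply ℝ ℝ i.1 (-weakDx (toL2 fun y => U t y * R t y)) := by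
  obtain ⟨p, θ, hθ, hp⟩ := i
  obtain ⟨h1, h2⟩ := hf.hasDerivAt_inner_ρ h hθ
  refine ⟨_, fun t => ?_, h2, fun t _ => ?_⟩
  · have : ∀ f, ContinuousLinearMap.apply ℝ ℝ p (toHNegOne f) = inner ℝ f (toL2 θ) := fun f => by
      change inner ℝ f p.1.fst = _
      rw [← hp]
      rfl
    simp only [this]
    exact h1 t
  · have : ∀ f, ContinuousLinearMap.apply ℝ ℝ p (-weakDx f) = inner ℝ f (toL2 (deriv θ)) :=
      fun f => by
        rw [weakDx, neg_neg]
        change inner ℝ f p.1.snd = _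
        rw [← hp]
        rfl
    rw [this]

theorem hasDerivAt_toL2_u {t : ℝ} (ht : t ∉ exceptionalTimes u₀ ρ₀) :
    HasDerivAt (fun s => toL2 (U s))
      (toL2 (source (U t) (R t)) - toL2 fun y => U t y * deriv (U t) y) t :=
  hasDerivAt_of_tested (l := fun i : {θ : ℝ → ℝ // IsTest θ} => innerSL ℝ (toL2 i.1))
    (N := fun i => ‖toL2 i.1‖)
    (F := fun t => toL2 (source (U t) (R t)) - toL2 fun y => U t y * deriv (U t) y)
    (fun _ _ hC he => norm_le_of_inner_testL2 hC fun θ hθ => by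
      simpa [real_inner_comm] using he ⟨θ, hθ⟩)
    (fun i e => by simpa [real_inner_comm] using abs_real_inner_le_norm e (toL2 i.1))
    (fun _ => norm_nonneg _) countable_exceptionalTimes (hf.tested_u h)
    ((hf.continuousAt_toL2_source h ht).sub
      (hf.continuousAt_toL2_mul h (fun s => (hf s).memLp_deriv h) (hf.continuousAt_toL2 h ht).1))

theorem exists_norm_toL2_u_sub_le : ∃ C, ∀ s t, ‖toL2 (U t) - toL2 (U s)‖ ≤ C * |t - s| := by
  obtain ⟨K, hK0, hK⟩ := hf.exists_abs_le h
  -- The source is at most 2 in absolute value, u at most `K`, and u_x has norm at most 2.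
  refine ⟨2 + K * 2, fun s t => ?_⟩
  refine norm_sub_le_of_tested (U := fun s => toL2 (U s))
    (l := fun i : {θ : ℝ → ℝ // IsTest θ} => innerSL ℝ (toL2 i.1))
    (N := fun i => ‖toL2 i.1‖)
    (F := fun t => toL2 (source (U t) (R t)) - toL2 fun y => U t y * deriv (U t) y)
    (fun _ _ hC he => norm_le_of_inner_testL2 hC fun θ hθ => by
      simpa [real_inner_comm] using he ⟨θ, hθ⟩)
    (fun i e => by simpa [real_inner_comm] using abs_real_inner_le_norm e (toL2 i.1))
    (fun _ => norm_nonneg _) countable_exceptionalTimes (hf.tested_u h) (by positivity)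
    (fun t => (norm_sub_le _ _).trans (add_le_add ?_ ?_)) s t
  · exact norm_toL2_le zero_le_two fun y hy => (hf t).abs_source_le h hy
  · exact (norm_toL2_mul_le ((hf t).continuous_u h) ((hf t).memLp_deriv h) (hK t)).trans
      (mul_le_mul_of_nonneg_left (hf.norm_deriv_le h t) hK0)

theorem hasDerivAt_toHNegOne_ρ {t : ℝ} (ht : t ∉ exceptionalTimes u₀ ρ₀) :
    HasDerivAt (fun s => toHNegOne (toL2 (R s)))
      (-weakDx (toL2 fun y => U t y * R t y)) t :=
  hasDerivAt_of_tested (l := fun i : testH1 => ContinuousLinearMap.apply ℝ ℝ i.1)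
    (N := fun i => ‖i.1‖) (F := fun t => -weakDx (toL2 fun y => U t y * R t y))
    (fun _ _ hC he => norm_le_of_testH1 hC fun p hp => he ⟨p, hp⟩)
    (fun i e => e.le_opNorm i.1)
    (fun _ => norm_nonneg _) countable_exceptionalTimes (hf.tested_ρ h)
    (continuous_weakDx.neg.continuousAt.comp
      (hf.continuousAt_toL2_mul h (fun s => (hf s).memLp_ρ h) (hf.continuousAt_toL2 h ht).2))

theorem exists_norm_toHNegOne_ρ_sub_le :
    ∃ C, ∀ s t, ‖toHNegOne (toL2 (R t)) - toHNegOne (toL2 (R s))‖ ≤ C * |t - s| := by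
  obtain ⟨K, hK0, hK⟩ := hf.exists_abs_le h
  obtain ⟨C, hC0, hC⟩ := exists_norm_weakDx_le
  refine ⟨K * 2 * C, fun s t => ?_⟩
  refine norm_sub_le_of_tested (U := fun s => toHNegOne (toL2 (R s)))
    (l := fun i : testH1 => ContinuousLinearMap.apply ℝ ℝ i.1)
    (N := fun i => ‖i.1‖) (F := fun t => -weakDx (toL2 fun y => U t y * R t y))
    (fun _ _ hC he => norm_le_of_testH1 hC fun p hp => he ⟨p, hp⟩)
    (fun i e => e.le_opNorm i.1)
    (fun _ => norm_nonneg _) countable_exceptionalTimes (hf.tested_ρ h) (by positivity)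
    (fun t => ?_) s t
  rw [ContinuousLinearMap.opNorm_neg]
  refine (hC _).trans (mul_le_mul_of_nonneg_right ?_ hC0)
  exact (norm_toL2_mul_le ((hf t).continuous_u h) ((hf t).memLp_ρ h) (hK t)).trans
    (mul_le_mul_of_nonneg_left (hf.norm_ρ_le h t) hK0)

end IsFlow

/-! ### Solutions given by the flow for nonnegative times. -/

theorem IsGivenByFlow.isFlowAt {u ρ : ℝ → ℝ → ℝ} (hg : IsGivenByFlow u₀ ρ₀ u ρ)
    (h : IsUnitData u₀ ρ₀) {t : ℝ} (ht : 0 ≤ t) : IsFlowAt u₀ ρ₀ t (u t) (ρ t) where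
  periodic_u := hg.periodic_u t ht
  periodic_ρ := hg.periodic_ρ t ht
  -- Derivatives within [0, ∞) are unique, including at the endpoint 0.
  comp_u x := (uniqueDiffOn_Ici (0 : ℝ) t ht).eq_deriv _ (hg.comp_u t ht x)
    (h.hasDerivAt_geoPhi t x).hasDerivWithinAt
  comp_ρ := (hg.comp_ρ t ht).mono fun x hx => (uniqueDiffOn_Ici (0 : ℝ) t ht).eq_deriv _ hx
    (hasDerivAt_geoRho t x).hasDerivWithinAt

/-- A pair given by the flow for `t ≥ 0` extends to all times. -/
theorem IsGivenByFlow.exists_isFlow {u ρ : ℝ → ℝ → ℝ} (hg : IsGivenByFlow u₀ ρ₀ u ρ)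
    (h : IsUnitData u₀ ρ₀) : ∃ U R, IsFlow u₀ ρ₀ U R ∧ ∀ t, 0 ≤ t → U t = u t ∧ R t = ρ t := by
  -- Negative times are filled with arbitrary states of the flow, so that two-sided time derivatives
  -- are available throughout.
  have : ∀ t, ∃ v r, IsFlowAt u₀ ρ₀ t v r ∧ (0 ≤ t → v = u t ∧ r = ρ t) := fun t => by
    by_cases ht : 0 ≤ t
    · exact ⟨u t, ρ t, hg.isFlowAt h ht, fun _ => ⟨rfl, rfl⟩⟩
    · obtain ⟨v, r, hvr⟩ := h.exists_isFlowAt t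
      exact ⟨v, r, hvr, fun ht' => absurd ht' ht⟩
  choose U R hUR using this
  exact ⟨U, R, fun t => (hUR t).1, fun t => (hUR t).2⟩

theorem IsUnitData.exists_isGivenByFlow (h : IsUnitData u₀ ρ₀) :
    ∃ u ρ, IsGivenByFlow u₀ ρ₀ u ρ := by
  choose U R hUR using h.exists_isFlowAt
  refine ⟨U, R, fun t _ => (hUR t).periodic_u, fun t _ => (hUR t).periodic_ρ, fun t _ x => ?_,
    fun t _ => ?_⟩
  · rw [(hUR t).comp_u]
    exact (h.hasDerivAt_geoPhi t x).hasDerivWithinAt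
  · filter_upwards [(hUR t).comp_ρ] with x hx
    rw [hx]
    exact (hasDerivAt_geoRho t x).hasDerivWithinAt

theorem ae_pos_notMem {S : Set ℝ} (hS : S.Countable) :
    ∀ᵐ t ∂(volume.restrict (Ici (0 : ℝ))), 0 < t ∧ t ∉ S := by
  filter_upwards [ae_restrict_mem measurableSet_Ici, ae_restrict_of_ae (hS.ae_notMem volume),
    ae_restrict_of_ae ((countable_singleton (0 : ℝ)).ae_notMem volume)] with t h1 h2 h3
  exact ⟨lt_of_le_of_ne h1 (Ne.symm h3), h2⟩

theorem IsGivenByFlow.isGlobalWeakSolution {u ρ : ℝ → ℝ → ℝ} (hg : IsGivenByFlow u₀ ρ₀ u ρ)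
    (h : IsUnitData u₀ ρ₀) : IsGlobalWeakSolution u₀ ρ₀ u ρ := by
  obtain ⟨U, R, hf, hUR⟩ := hg.exists_isFlow h
  have hS : (exceptionalTimes u₀ ρ₀).Countable := countable_exceptionalTimes
  -- Agreement near t requires t > 0. The time 0 is discarded as a null set.
  have hev : ∀ {t : ℝ}, 0 < t → ∀ᶠ s in 𝓝 t, u s = U s ∧ ρ s = R s := fun ht => by
    filter_upwards [Ioi_mem_nhds ht] with s hs
    exact ⟨(hUR s (le_of_lt hs)).1.symm, (hUR s (le_of_lt hs)).2.symm⟩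
  have hφ0 : ∀ x, geoPhi u₀ ρ₀ 0 x = x := fun x => by simp [h.geoPhi_eq]
  constructor
  · exact fun t ht => (hg.isFlowAt h ht).memH1 h
  · exact fun t ht => (hg.isFlowAt h ht).memL2 h
  · refine (hf.continuous_uncurry h).continuousOn.congr fun q hq => ?_
    simp only [Function.uncurry, (hUR q.1 hq.1).1]
  · intro x
    have := (hg.isFlowAt h le_rfl).comp_u x
    rw [hφ0] at this
    rw [this]
    simp [geoPhiT]
  · filter_upwards [(hg.isFlowAt h le_rfl).comp_ρ] with x hx
    rw [hφ0] at hx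
    rw [hx]
    simp [geoPhiX_eq]
  · refine (memLp_top_of_bound (f := fun t => toL2 (deriv (U t)))
      (aestronglyMeasurable_of_continuousAt_off_countable hS fun t ht =>
        (hf.continuousAt_toL2 h ht).1).restrict 2
      (ae_of_all _ (hf.norm_deriv_le h))).ae_eq ?_
    filter_upwards [ae_restrict_mem measurableSet_Ici] with t ht
    rw [(hUR t ht).1]
  · refine (memLp_top_of_bound (f := fun t => toL2 (R t))
      (aestronglyMeasurable_of_continuousAt_off_countable hS fun t ht =>
        (hf.continuousAt_toL2 h ht).2).restrict 2
      (ae_of_all _ (hf.norm_ρ_le h))).ae_eq ?_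
    filter_upwards [ae_restrict_mem measurableSet_Ici] with t ht
    rw [(hUR t ht).2]
  · intro T hT
    obtain ⟨C, hC⟩ := hf.exists_norm_toL2_u_sub_le h
    refine absolutelyContinuousOnInterval_of_dist_le (C := C) hT.le fun s t hs ht => ?_
    rw [← (hUR s hs).1, ← (hUR t ht).1, dist_eq_norm]
    exact hC s t
  · filter_upwards [ae_pos_notMem hS] with t ht
    have h1 := (hf.hasDerivAt_toL2_u h ht.2).congr_of_eventuallyEq
      ((hev ht.1).mono fun s hs => by simp only [hs.1] : (fun s => toL2 (u s)) =ᶠ[𝓝 t] _)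
    rw [(hUR t ht.1.le).1, (hUR t ht.1.le).2] at h1
    exact h1
  · intro T hT
    obtain ⟨C, hC⟩ := hf.exists_norm_toHNegOne_ρ_sub_le h
    refine absolutelyContinuousOnInterval_of_dist_le (C := C) hT.le fun s t hs ht => ?_
    rw [← (hUR s hs).2, ← (hUR t ht).2,
      dist_eq_norm (toHNegOne (toL2 (R t))) (toHNegOne (toL2 (R s)))]
    exact hC s t
  · filter_upwards [ae_pos_notMem hS] with t ht
    have h1 := (hf.hasDerivAt_toHNegOne_ρ h ht.2).congr_of_eventuallyEq
      ((hev ht.1).mono fun s hs => by simp only [hs.2] : (fun s => toHNegOne (toL2 (ρ s))) =ᶠ[𝓝 t] _)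
    rw [(hUR t ht.1.le).1, (hUR t ht.1.le).2] at h1
    exact h1

end HunterSaxton

/-! ### Assembly of existence, the weak equations and the energy identities. -/

theorem mainTheorem3 (u₀ ρ₀ : ℝ → ℝ) (hu₀ : MemH1 u₀) (hρ₀ : MemL2 ρ₀) (h0 : u₀ 0 = 0)
    (hE : normSq (deriv u₀) + normSq ρ₀ = 4) :
    (∃ u ρ : ℝ → ℝ → ℝ, IsGivenByFlow u₀ ρ₀ u ρ) ∧
    ∀ u ρ : ℝ → ℝ → ℝ, IsGivenByFlow u₀ ρ₀ u ρ →
      IsGlobalWeakSolution u₀ ρ₀ u ρ ∧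
      (∀ t, 0 ≤ t →
        (Real.sin t = 0 → normA (u t) (ρ t) ^ 2 = normA u₀ ρ₀ ^ 2) ∧
        (Real.sin t ≠ 0 → normA (u t) (ρ t) ^ 2 = normA u₀ ρ₀ ^ 2 -
          1 / Real.sin t ^ 2 *
            circleMeasure.real ({x | deriv u₀ x = -2 * Real.cot t} ∩ {x | ρ₀ x = 0}))) ∧
      ∀ᵐ t ∂(volume.restrict (Ici (0 : ℝ))),
        normSq (deriv (u t)) + normSq (ρ t) = normSq (deriv u₀) + normSq ρ₀ := by
  have h : IsUnitData u₀ ρ₀ := ⟨hu₀, hρ₀, h0, hE⟩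
  refine ⟨h.exists_isGivenByFlow, fun u ρ hg => ⟨hg.isGlobalWeakSolution h, fun t ht =>
    ⟨fun hs => ?_, fun hs => ?_⟩, ?_⟩⟩
  · rw [normA_sq, normA_sq, hE, (hg.isFlowAt h ht).normSq_add_normSq_of_sin_eq_zero h hs]
  -- The factor 1/4 in the squared norm turns the loss 4/sin² t into 1/sin² t.
  · rw [normA_sq, normA_sq, hE, (hg.isFlowAt h ht).normSq_add_normSq_of_sin_ne_zero h hs]
    ring
  · obtain ⟨U, R, hf, hUR⟩ := hg.exists_isFlow h
    filter_upwards [ae_pos_notMem countable_exceptionalTimes] with t ht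
    rw [← (hUR t ht.1.le).1, ← (hUR t ht.1.le).2, hE]
    exact hf.normSq_add_normSq h ht.2
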